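/- Fix a symbol $\tau$ (the invisible action). A labelled transition system (LTS) is a tuple $L=(S,\Sigma,\Delta,\hat s)$, where the set $S$ of states and the alphabet $\Sigma$ are arbitrary (possibly infinite) sets, $\tau\notin\Sigma$, $\Delta\subseteq S\times(\Sigma\cup\{\tau\})\times S$ and $\hat s\in S$. Write $\Sigma(L)=\Sigma$. For a finite sequence $\sigma\in\Sigma^*$ (an infinite sequence $\xi\in\Sigma^\omega$) write $s\stackrel{\sigma}{\Rightarrow}s'$ (respectively $s\stackrel{\xi}{\Rightarrow}$) if there is a path from $s$ to $s'$ (respectively, starting at $s$) whose sequence of labels, after all occurrences of $\tau$ have been deleted, is $\sigma$ (respectively $\xi$), and write $s\stackrel{\tau^\omega}{\longrightarrow}$ if an infinite path of $\tau$-transitions starts at $s$. Define - $\mathit{Sf}(L)=\{(\sigma,A)\in\Sigma^*\times 2^\Sigma \mid \exists s:\ \hat s\stackrel{\sigma}{\Rightarrow}s \text{ and } (s,a,s')\notin\Delta \text{ for all } a\in A\cup\{\tau\} \text{ and all } s'\}$ (stable failures); - $\mathit{Div}(L)=\{\sigma\in\Sigma^* \mid \exists s:\ \hat s\stackrel{\sigma}{\Rightarrow}s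 \text{ and } s\stackrel{\tau^\omega}{\longrightarrow}\}$ (divergence traces); - $\mathit{Inf}(L)=\{\xi\in\Sigma^\omega \mid \hat s\stackrel{\xi}{\Rightarrow}\}$ (infinite traces); - $\mathit{eanI}(L)=\{a_1a_2\cdots\in\mathit{Inf}(L) \mid \exists n\ge 0\ \forall i\ge n:\ a_1\cdots a_i\notin\mathit{Div}(L)\}$ (eventually-always-nondivergent infinite traces); - $\mathit{aenI}(L)=\{a_1a_2\cdots\in\mathit{Inf}(L) \mid \forall n\ge 0\ \exists i\ge n:\ a_1\cdots a_i\notin\mathit{Div}(L)\}$ (always-eventually-nondivergent infinite traces). The equivalence induced by functions $X_1,\dots,X_k$ on LTSs relates $L$ and $L'$ if and only if $X_j(L)=X_j(L')$ for all $j$. CFFD-equivalence $\doteq$ is the equivalence induced by $\Sigma$, $\mathit{Sf}$, $\mathit{Div}$ and $\mathit{Inf}$. A relation $\cong$ preserves $X$ if $L\cong L'$ implies $X(L)=X(L')$ for all LTSs $L,L'$. The operators on LTSs are the following. - Action prefix $a.L$, for $a\neq\tau$: add $a$ to the alphabet and add a new initial state whose only transition is labelled $a$ and leads to $\hat s$.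 - Hiding $L\setminus A$, for a set $A$: remove $A$ from the alphabet and relabel every transition with a label in $A$ to $\tau$. - Relational renaming $L\Phi$, for a set $\Phi$ of pairs of symbols other than $\tau$: let $\Phi(a,b)$ mean that $(a,b)\in\Phi$, or that $a=b$ and $a$ is not the first component of any pair in $\Phi$; the alphabet of $L\Phi$ is $\{b\mid\exists a\in\Sigma:\Phi(a,b)\}$ and its transitions are the $(s,b,s')$ such that $(s,a,s')\in\Delta$ and $\Phi(a,b)$ for some $a$. - Parallel composition $L_1\,||\,L_2$: the states are $S_1\times S_2$, the initial state is $(\hat s_1,\hat s_2)$, the alphabet is $\Sigma_1\cup\Sigma_2$; actions in $\Sigma_1\cap\Sigma_2$ are executed by both components simultaneously, while $\tau$ and every other action are executed by one component alone, the other staying in its state. A congruence is an equivalence relation $\cong$ on the LTSs such that $L\cong L'$ implies $a.L\cong a.L'$, $L\setminus A\cong L'\setminus A$, $L\Phi\cong L'\Phi$, $L\,||\,M\cong L'\,||\,M$ and $M\,||\,L\cong M\,||\,L'$ for all $a\neq\tau$, all sets $A$, all sets $\Phi$ as above and all LTSs $M$. Theorem. If $\cong$ is a congruence, $\doteq$ implies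 $\cong$ (that is, $L\doteq L'$ implies $L\cong L'$ for all LTSs $L,L'$), and $\cong$ preserves $\mathit{Sf}$ and $\mathit{Div}$ but does not preserve $\mathit{aenI}$, then $\cong$ is the equivalence induced by $\Sigma$, $\mathit{Sf}$, $\mathit{Div}$ and $\mathit{eanI}$; that is, for all LTSs $L,L'$, $$L\cong L' \iff \Sigma(L)=\Sigma(L'),\ \mathit{Sf}(L)=\mathit{Sf}(L'),\ \mathit{Div}(L)=\mathit{Div}(L')\ \text{and}\ \mathit{eanI}(L)=\mathit{eanI}(L').$$ -/

import Mathlib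

universe u

/-- Visible actions.  Any set may serve as a label, so the labels form a proper class from the
point of view of `Type u`, and every alphabet (a set) leaves infinitely many labels unused. -/
abbrev Label : Type (u + 1) := ZFSet.{u}

/-- Actions: `some a` is the visible action `a`, and `none` is the invisible action `τ`. -/
abbrev Act : Type (u + 1) := Option Label.{u}

/-- A labelled transition system `(S, Σ, Δ, ŝ)`, finite or infinite.  Its state space and its
alphabet are sets (and not proper classes): the former is a type in `Type u`, and the latter is
`u`-small.  The invisible action is not in the alphabet, because it is not a label. -/
structure LTS : Type (u + 1) where
  State : Type u
  alphabet : Set Label.{u}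
  small_alphabet : Small.{u} alphabet
  trans : State → Act.{u} → State → Prop
  mem_alphabet : ∀ {s : State} {a : Label.{u}} {t : State}, trans s (some a) t → a ∈ alphabet
  init : State

namespace LTS

/-! ### The four operators -/

/-- Action prefix `a.L`.  The new initial state is `none : Option L.State`. -/
def pre (a : Label.{u}) (L : LTS.{u}) : LTS.{u} where
  State := Option L.State
  alphabet := L.alphabet ∪ {a}
  small_alphabet := by
    have := L.small_alphabet
    exact small_union _ _
  trans := fun s b t =>
    (∃ s₀ t₀, s = some s₀ ∧ t = some t₀ ∧ L.trans s₀ b t₀) ∨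
      (s = none ∧ b = some a ∧ t = some L.init)
  mem_alphabet := by
    rintro s b t (⟨s₀, t₀, -, -, h⟩ | ⟨-, h, -⟩)
    · exact Or.inl (L.mem_alphabet h)
    · exact Or.inr (Option.some.inj h)
  init := none

/-- Hiding `L \ A`.  Only the part of `A` inside the alphabet of `L` matters. -/
def hide (L : LTS.{u}) (A : Set Label.{u}) : LTS.{u} where
  State := L.State
  alphabet := L.alphabet \ A
  small_alphabet := by
    have := L.small_alphabet
    exact small_subset Set.sdiff_subset
  trans := fun s a t =>
    ∃ b, L.trans s b t ∧ ((a = b ∧ b ∉ some '' A) ∨ (a = none ∧ b ∈ some '' A))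
  mem_alphabet := by
    rintro s a t ⟨b, h, ⟨rfl, hb⟩ | ⟨h', -⟩⟩
    · exact ⟨L.mem_alphabet h, fun ha => hb ⟨a, ha, rfl⟩⟩
    · cases h'
  init := L.init

/-- `Φ(a, b)` for labels: `(a, b) ∈ Φ`, or `a = b` and `a` is not in the domain of `Φ`. -/
def RenLabel (Φ : Set (Label.{u} × Label.{u})) (a b : Label.{u}) : Prop :=
  (a, b) ∈ Φ ∨ (a = b ∧ ∀ c, (a, c) ∉ Φ)

/-- `Φ(a, b)` for actions: `τ` is in neither the domain nor the range of `Φ`. -/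
def RenAction (Φ : Set (Label.{u} × Label.{u})) : Act.{u} → Act.{u} → Prop
  | none, none => True
  | some a, some b => RenLabel Φ a b
  | _, _ => False

/-- Relational renaming `LΦ`, where `Φ` is a set (and not a proper class) of pairs of labels. -/
def rename (L : LTS.{u}) (Φ : Set (Label.{u} × Label.{u})) (hΦ : Small.{u} Φ) : LTS.{u} where
  State := L.State
  alphabet := {b | ∃ a ∈ L.alphabet, RenLabel Φ a b}
  small_alphabet := by
    have := L.small_alphabet
    have hs : {b | ∃ a ∈ L.alphabet, RenLabel Φ a b} ⊆ L.alphabet ∪ Prod.snd '' Φ := by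
      rintro b ⟨a, ha, h | ⟨rfl, -⟩⟩
      · exact Or.inr ⟨(a, b), h, rfl⟩
      · exact Or.inl ha
    have : Small.{u} (L.alphabet ∪ Prod.snd '' Φ : Set Label.{u}) := small_union _ _
    exact small_subset hs
  trans := fun s b t => ∃ a, L.trans s a t ∧ RenAction Φ a b
  mem_alphabet := by
    rintro s b t ⟨a, h, hr⟩
    cases a with
    | none => exact hr.elim
    | some a => exact ⟨a, L.mem_alphabet h, hr⟩
  init := L.init

/-- Parallel composition `L₁ || L₂`: the two components synchronize on their common labels. -/
def par (L₁ L₂ : LTS.{u}) : LTS.{u} where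
  State := L₁.State × L₂.State
  alphabet := L₁.alphabet ∪ L₂.alphabet
  small_alphabet := by
    have := L₁.small_alphabet
    have := L₂.small_alphabet
    exact small_union _ _
  trans := fun s a t =>
    (a ∉ some '' L₂.alphabet ∧ L₁.trans s.1 a t.1 ∧ t.2 = s.2) ∨
    (a ∉ some '' L₁.alphabet ∧ L₂.trans s.2 a t.2 ∧ t.1 = s.1) ∨
    (a ∈ some '' L₁.alphabet ∧ a ∈ some '' L₂.alphabet ∧
      L₁.trans s.1 a t.1 ∧ L₂.trans s.2 a t.2)
  mem_alphabet := by
    rintro s a t (⟨-, h, -⟩ | ⟨-, h, -⟩ | ⟨-, -, h, -⟩)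
    · exact Or.inl (L₁.mem_alphabet h)
    · exact Or.inr (L₂.mem_alphabet h)
    · exact Or.inl (L₁.mem_alphabet h)
  init := (L₁.init, L₂.init)

/-! ### Paths and semantic sets -/

/-- `s =ε⇒ t`: finitely many (possibly zero) invisible transitions lead from `s` to `t`. -/
def TauStar (L : LTS.{u}) : L.State → L.State → Prop :=
  Relation.ReflTransGen (fun s t => L.trans s none t)

/-- `s =σ⇒ t` for a finite sequence `σ` of labels. -/
def Path (L : LTS.{u}) : List Label.{u} → L.State → L.State → Prop
  | [], s, t => L.TauStar s t
  | a :: σ, s, t => ∃ s' v, L.TauStar s s' ∧ L.trans s' (some a) v ∧ L.Path σ v t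

/-- `s =ξ⇒` for an infinite sequence `ξ` of labels. -/
def InfPath (L : LTS.{u}) (ξ : ℕ → Label.{u}) (s : L.State) : Prop :=
  ∃ p q : ℕ → L.State, p 0 = s ∧
    ∀ i, L.TauStar (p i) (q i) ∧ L.trans (q i) (some (ξ i)) (p (i + 1))

/-- An infinite sequence of invisible transitions starts at `s`. -/
def Diverges (L : LTS.{u}) (s : L.State) : Prop :=
  ∃ p : ℕ → L.State, p 0 = s ∧ ∀ i, L.trans (p i) none (p (i + 1))

/-- Stable failures. -/
def Sf (L : LTS.{u}) : Set (List Label.{u} × Set Label.{u}) :=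
  {x | x.2 ⊆ L.alphabet ∧ ∃ s, L.Path x.1 L.init s ∧
    (∀ t, ¬ L.trans s none t) ∧ ∀ a ∈ x.2, ∀ t, ¬ L.trans s (some a) t}

/-- Divergence traces. -/
def Div (L : LTS.{u}) : Set (List Label.{u}) :=
  {σ | ∃ s, L.Path σ L.init s ∧ L.Diverges s}

/-- Infinite traces. -/
def Inf (L : LTS.{u}) : Set (ℕ → Label.{u}) :=
  {ξ | L.InfPath ξ L.init}

/-- The prefix of length `n` of an infinite sequence. -/
def prefixOf (ξ : ℕ → Label.{u}) (n : ℕ) : List Label.{u} :=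
  (List.range n).map ξ

/-- Eventually-always-nondivergent infinite traces. -/
def eanI (L : LTS.{u}) : Set (ℕ → Label.{u}) :=
  {ξ | ξ ∈ L.Inf ∧ ∃ n, ∀ i, n ≤ i → prefixOf ξ i ∉ L.Div}

/-- Always-eventually-nondivergent infinite traces. -/
def aenI (L : LTS.{u}) : Set (ℕ → Label.{u}) :=
  {ξ | ξ ∈ L.Inf ∧ ∀ n, ∃ i, n ≤ i ∧ prefixOf ξ i ∉ L.Div}

/-! ### Equivalences and congruences -/

/-- CFFD-equivalence, the equivalence induced by `Σ`, `Sf`, `Div` and `Inf`. -/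
def CFFD (L L' : LTS.{u}) : Prop :=
  L.alphabet = L'.alphabet ∧ L.Sf = L'.Sf ∧ L.Div = L'.Div ∧ L.Inf = L'.Inf

/-- A congruence with respect to action prefix, hiding, relational renaming and parallel
composition. -/
structure IsCongruence (R : LTS.{u} → LTS.{u} → Prop) : Prop where
  equivalence : Equivalence R
  pre : ∀ {L L'}, R L L' → ∀ a : Label.{u}, R (L.pre a) (L'.pre a)
  hide : ∀ {L L'}, R L L' → ∀ A : Set Label.{u}, R (L.hide A) (L'.hide A)
  rename : ∀ {L L'}, R L L' → ∀ (Φ : Set (Label.{u} × Label.{u})) (hΦ : Small.{u} Φ),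
    R (L.rename Φ hΦ) (L'.rename Φ hΦ)
  par_right : ∀ {L L'}, R L L' → ∀ M : LTS.{u}, R (L.par M) (L'.par M)
  par_left : ∀ {L L'}, R L L' → ∀ M : LTS.{u}, R (M.par L) (M.par L')

/-- `R` preserves the semantic function `X`. -/
def Preserves {β : Type*} (R : LTS.{u} → LTS.{u} → Prop) (X : LTS.{u} → β) : Prop :=
  ∀ L L', R L L' → X L = X L'

end LTS

/-! The congruence sees at least `Σ` and `eanI`. A loop on one action tests whether that action is
in the alphabet. For `eanI`, let `L` follow a fixed `ξ`, insert a fresh `c` after at least `n`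
labels and hide everything else. If no prefix of `ξ` of length at least `n` is a divergence trace,
then `[c]` is a divergence trace of the result exactly when `ξ ∈ L.Inf` (`mem_Div_monitored`,
`mem_Inf_of_mem_Div_monitored`).

It sees no more than the four invariants. A trace witnessing that `aenI` is not preserved yields,
once all its labels are renamed to `a`, two related counters: only `G₁` can execute `a` for ever,
and both are free of divergence after arbitrarily large numbers of `a` (`exists_counters`). If `L`
and `L'` agree on the invariants, `tracked` behaves like `L` or follows a trace in `L'.Inf`, and the
counter must tick whenever a divergence trace of `L` is reached. As `eanI` agrees, a trace in
`L'.Inf` outside `L.Inf` has infinitely many divergent prefixes, so it needs infinitely many ticks: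
`G₁` supplies them, `G₂` cannot. The counter can diverge only where `L` can already, so `Sf` and
`Div` stay those of `L`. With `G₂` the result is CFFD-equivalent to `L`; with `G₁` its infinite
traces are `L.Inf ∪ L'.Inf`. The same construction from `L'` gives the same union, and transitivity
finishes. -/

namespace LTS

/-! ### Runs, traces and divergence -/

/-- `L.Run σ s`: the state `s` is reached from the initial state by a path with trace `σ`. -/
inductive Run (L : LTS.{u}) : List Label.{u} → L.State → Prop
  | init : Run L [] L.init
  | tau {σ s t} : Run L σ s → L.trans s none t → Run L σ t
  | vis {σ s t a} : Run L σ s → L.trans s (some a) t → Run L (σ ++ [a]) t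

theorem Run.tauStar {L : LTS.{u}} {σ : List Label.{u}} {s t : L.State} (h : L.Run σ s)
    (ht : L.TauStar s t) : L.Run σ t := by
  induction ht with
  | refl => exact h
  | tail _ h₁ ih => exact ih.tau h₁

theorem Run.path {L : LTS.{u}} {σ ρ : List Label.{u}} {s t : L.State} (h : L.Run σ s)
    (hp : L.Path ρ s t) : L.Run (σ ++ ρ) t := by
  induction ρ generalizing σ s with
  | nil => simpa using h.tauStar hp
  | cons a ρ ih =>
    obtain ⟨s', v, h₁, h₂, h₃⟩ := hp
    simpa using ih ((h.tauStar h₁).vis h₂) h₃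

theorem Path.tau {L : LTS.{u}} {σ : List Label.{u}} {s t v : L.State} (h : L.Path σ s t)
    (ht : L.trans t none v) : L.Path σ s v := by
  induction σ generalizing s with
  | nil => exact Relation.ReflTransGen.tail h ht
  | cons a σ ih =>
    obtain ⟨s', w, h₁, h₂, h₃⟩ := h
    exact ⟨s', w, h₁, h₂, ih h₃⟩

theorem Path.vis {L : LTS.{u}} {σ : List Label.{u}} {s t v : L.State} {a : Label.{u}}
    (h : L.Path σ s t) (ht : L.trans t (some a) v) : L.Path (σ ++ [a]) s v := by
  induction σ generalizing s with
  | nil => exact ⟨t, v, h, ht, Relation.ReflTransGen.refl⟩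
  | cons b σ ih =>
    obtain ⟨s', w, h₁, h₂, h₃⟩ := h
    exact ⟨s', w, h₁, h₂, ih h₃⟩

/-- `Path` consumes labels from the front, `Run` appends them at the back; the latter suits
induction on invariants of reachable states. -/
theorem path_init_iff_run {L : LTS.{u}} {σ : List Label.{u}} {s : L.State} :
    L.Path σ L.init s ↔ L.Run σ s := by
  refine ⟨fun h => by simpa using Run.init.path h, fun h => ?_⟩
  induction h with
  | init => exact Relation.ReflTransGen.refl
  | tau _ h ih => exact ih.tau h
  | vis _ h ih => exact ih.vis h

theorem mem_Div_iff {L : LTS.{u}} {σ : List Label.{u}} :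
    σ ∈ L.Div ↔ ∃ s, L.Run σ s ∧ L.Diverges s := by
  simp [Div, path_init_iff_run]

theorem mem_Sf_iff {L : LTS.{u}} {x : List Label.{u} × Set Label.{u}} :
    x ∈ L.Sf ↔ x.2 ⊆ L.alphabet ∧ ∃ s, L.Run x.1 s ∧
      (∀ t, ¬ L.trans s none t) ∧ ∀ a ∈ x.2, ∀ t, ¬ L.trans s (some a) t := by
  simp [Sf, path_init_iff_run]

theorem not_diverges_iff_acc {L : LTS.{u}} {s : L.State} :
    ¬ L.Diverges s ↔ Acc (fun t s => L.trans s none t) s := by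
  rw [← not_iff_not, not_not, not_acc_iff_exists_descending_chain]
  rfl

/-- Nondivergence is accessibility, which passes to the transitive closure, so progress may take
several steps at a time. -/
theorem Diverges.of_progress {L : LTS.{u}} {X : L.State → Prop}
    (h : ∀ s, X s → ∃ t, Relation.TransGen (fun s t => L.trans s none t) s t ∧ X t)
    {s : L.State} (hs : X s) : L.Diverges s := by
  by_contra hd
  have ha := (not_diverges_iff_acc.1 hd).transGen
  induction ha with
  | intro s _ ih =>
    obtain ⟨t, ht, hX⟩ := h s hs
    have ht' := Relation.transGen_swap.2 ht
    refine ih t ht' hX fun h' => hd ?_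
    obtain ⟨q, hq₀, hq⟩ := h'
    by_contra hs'
    have hacc := (not_diverges_iff_acc.1 hs').inv_of_transGen ht'
    exact not_diverges_iff_acc.2 hacc ⟨q, hq₀, hq⟩

/-- Every trace is a divergence trace or has a stable failure. -/
theorem Run.mem_Div_or_mem_Sf {L : LTS.{u}} {σ : List Label.{u}} {s : L.State}
    (h : L.Run σ s) : σ ∈ L.Div ∨ (σ, ∅) ∈ L.Sf := by
  by_cases hd : L.Diverges s
  · exact Or.inl (mem_Div_iff.2 ⟨s, h, hd⟩)
  · have ha := not_diverges_iff_acc.1 hd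
    clear hd
    induction ha with
    | intro s _ ih =>
      by_cases ht : ∃ t, L.trans s none t
      · obtain ⟨t, ht⟩ := ht
        exact ih t ht (h.tau ht)
      · push Not at ht
        exact Or.inr (mem_Sf_iff.2 ⟨Set.empty_subset _, s, h, ht, by simp⟩)

/-- Two systems with the same stable failures and divergence traces have the same traces. -/
theorem Run.transfer {L L' : LTS.{u}} (hSf : L.Sf = L'.Sf) (hDiv : L.Div = L'.Div)
    {σ : List Label.{u}} {s : L.State} (h : L.Run σ s) : ∃ s', L'.Run σ s' := by
  rcases h.mem_Div_or_mem_Sf with h | h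
  · rw [hDiv, mem_Div_iff] at h
    exact h.imp fun _ h => h.1
  · rw [hSf, mem_Sf_iff] at h
    exact h.2.imp fun _ h => h.1

theorem Run.mem_alphabet {L : LTS.{u}} {σ : List Label.{u}} {s : L.State} (h : L.Run σ s)
    {a : Label.{u}} (ha : a ∈ σ) : a ∈ L.alphabet := by
  induction h with
  | init => simp at ha
  | tau _ _ ih => exact ih ha
  | vis _ h ih =>
    rcases List.mem_append.1 ha with ha | ha
    · exact ih ha
    · rw [List.mem_singleton.1 ha]
      exact L.mem_alphabet h

/-! ### Infinite traces -/

theorem prefixOf_succ (ξ : ℕ → Label.{u}) (n : ℕ) :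
    prefixOf ξ (n + 1) = prefixOf ξ n ++ [ξ n] := by
  simp [prefixOf, List.range_succ]

@[simp] theorem prefixOf_zero (ξ : ℕ → Label.{u}) : prefixOf ξ 0 = [] := rfl

@[simp] theorem length_prefixOf (ξ : ℕ → Label.{u}) (n : ℕ) : (prefixOf ξ n).length = n := by
  simp [prefixOf]

/-- Dependent choice: `X n` is an invariant of the state reached after `n` labels. The constructions
of infinite paths below rest on this. -/
theorem InfPath.of_progress {L : LTS.{u}} {ξ : ℕ → Label.{u}} {X : ℕ → L.State → Prop}
    (h : ∀ n s, X n s → ∃ s' t, L.TauStar s s' ∧ L.trans s' (some (ξ n)) t ∧ X (n + 1) t)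
    {s : L.State} (hs : X 0 s) : L.InfPath ξ s := by
  choose! q t hq ht hX using h
  let p : ℕ → L.State := fun n => Nat.rec s (fun n s => t n s) n
  have hp : ∀ n, X n (p n) := fun n => by
    induction n with
    | zero => exact hs
    | succ n ih => exact hX n _ ih
  exact ⟨p, fun n => q n (p n), rfl, fun n => ⟨hq n _ (hp n), ht n _ (hp n)⟩⟩

theorem InfPath.exists_step {L : LTS.{u}} {ξ : ℕ → Label.{u}} {s : L.State}
    (h : L.InfPath ξ s) : ∃ s' t, L.TauStar s s' ∧ L.trans s' (some (ξ 0)) t ∧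
      L.InfPath (fun i => ξ (i + 1)) t := by
  obtain ⟨p, q, rfl, h⟩ := h
  exact ⟨q 0, p 1, (h 0).1, (h 0).2, fun i => p (i + 1), fun i => q (i + 1), rfl,
    fun i => h (i + 1)⟩

theorem InfPath.exists_step_shift {L : LTS.{u}} {ξ : ℕ → Label.{u}} {n : ℕ} {s : L.State}
    (h : L.InfPath (fun i => ξ (i + n)) s) : ∃ s' t, L.TauStar s s' ∧
      L.trans s' (some (ξ n)) t ∧ L.InfPath (fun i => ξ (i + (n + 1))) t := by
  obtain ⟨s', t, h₁, h₂, h₃⟩ := h.exists_step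
  refine ⟨s', t, h₁, by simpa using h₂, ?_⟩
  have : (fun i => ξ (i + 1 + n)) = fun i => ξ (i + (n + 1)) := by
    funext i
    congr 1
    omega
  rwa [this] at h₃

theorem InfPath.of_step_shift {L : LTS.{u}} {ξ : ℕ → Label.{u}} {n : ℕ} {s t : L.State}
    (h : L.trans s (some (ξ n)) t) (ht : L.InfPath (fun i => ξ (i + (n + 1))) t) :
    L.InfPath (fun i => ξ (i + n)) s := by
  refine InfPath.of_progress
    (X := fun m v => (m = 0 ∧ v = s) ∨
      ∃ k, m = k + 1 ∧ L.InfPath (fun i => ξ (i + (n + 1 + k))) v) ?_ (Or.inl ⟨rfl, rfl⟩)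
  rintro m v (⟨rfl, rfl⟩ | ⟨k, rfl, hk⟩)
  · exact ⟨v, t, Relation.ReflTransGen.refl, by simpa using h, Or.inr ⟨0, rfl, ht⟩⟩
  · obtain ⟨s', w, h₁, h₂, h₃⟩ := hk.exists_step_shift
    refine ⟨s', w, h₁, ?_, Or.inr ⟨k + 1, rfl, h₃⟩⟩
    rwa [show k + 1 + n = n + 1 + k by omega]

theorem InfPath.tauStar {L : LTS.{u}} {ξ : ℕ → Label.{u}} {s t : L.State}
    (h : L.TauStar s t) (ht : L.InfPath ξ t) : L.InfPath ξ s := by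
  obtain ⟨p, q, rfl, hpq⟩ := ht
  refine ⟨fun n => Nat.casesOn n s fun n => p (n + 1), q, rfl, fun i => ?_⟩
  cases i with
  | zero => exact ⟨Relation.ReflTransGen.trans h (hpq 0).1, (hpq 0).2⟩
  | succ i => exact hpq (i + 1)

/-- The last transition of the run is moved to the front of the infinite path until the run is
empty. -/
theorem Run.mem_Inf {L : LTS.{u}} {ξ : ℕ → Label.{u}} {n : ℕ} {s : L.State}
    (h : L.Run (prefixOf ξ n) s) (hs : L.InfPath (fun i => ξ (i + n)) s) : ξ ∈ L.Inf := by
  generalize hσ : prefixOf ξ n = σ at h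
  induction h generalizing n with
  | init =>
    obtain rfl : n = 0 := by simpa using congrArg List.length hσ
    exact hs
  | tau _ h ih => exact ih (hs.tauStar (Relation.ReflTransGen.single h)) hσ
  | vis _ h ih =>
    cases n with
    | zero => simp at hσ
    | succ n =>
      rw [prefixOf_succ] at hσ
      obtain ⟨h₁, h₂⟩ := List.append_inj' hσ rfl
      obtain rfl := List.singleton_injective h₂
      exact ih (InfPath.of_step_shift h hs) h₁

theorem exists_run_of_mem_Inf {L : LTS.{u}} {ξ : ℕ → Label.{u}} (h : ξ ∈ L.Inf) (n : ℕ) :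
    ∃ s, L.Run (prefixOf ξ n) s ∧ L.InfPath (fun i => ξ (i + n)) s := by
  induction n with
  | zero => exact ⟨L.init, Run.init, h⟩
  | succ n ih =>
    obtain ⟨s, hs, hi⟩ := ih
    obtain ⟨s', t, h₁, h₂, h₃⟩ := hi.exists_step_shift
    exact ⟨t, prefixOf_succ ξ n ▸ (hs.tauStar h₁).vis h₂, h₃⟩

theorem mem_alphabet_of_mem_Inf {L : LTS.{u}} {ξ : ℕ → Label.{u}} (h : ξ ∈ L.Inf) (n : ℕ) :
    ξ n ∈ L.alphabet := by
  obtain ⟨s, hs, -⟩ := exists_run_of_mem_Inf h (n + 1)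
  exact hs.mem_alphabet (by simp [prefixOf_succ])

/-! ### Smallness -/

/-- Needed because a state of the tracker stores an infinite trace and must live in `Type u`. -/
theorem small_Inf (L : LTS.{u}) : Small.{u} L.Inf := by
  have := L.small_alphabet
  refine small_of_injective
    (f := fun (ξ : L.Inf) (n : ℕ) => (⟨ξ.1 n, mem_alphabet_of_mem_Inf ξ.2 n⟩ : L.alphabet)) ?_
  intro ξ ζ h
  ext1
  funext n
  exact congrArg Subtype.val (congrFun h n)

/-- By smallness `B` is itself a set, hence a label, and by foundation it is not its own element. -/
theorem exists_label_notMem (B : Set Label.{u}) (hB : Small.{u} B) : ∃ a : Label.{u}, a ∉ B := by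
  let x : ZFSet.{u} := ZFSet.range fun i : Shrink.{u} B => ((equivShrink B).symm i : ZFSet.{u})
  refine ⟨x, fun hx => ZFSet.mem_irrefl x ?_⟩
  rw [ZFSet.mem_range]
  exact ⟨equivShrink B ⟨x, hx⟩, by simp⟩

/-! ### A congruence that preserves `Sf` and `Div` preserves the alphabet -/

/-- The one-state system that repeats the action `a`. -/
def loop (a : Label.{u}) : LTS.{u} where
  State := PUnit
  alphabet := {a}
  small_alphabet := inferInstance
  trans := fun _ b _ => b = some a
  mem_alphabet := fun h => Option.some.inj h
  init := PUnit.unit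

/-- When `L` also controls `a`, the loop can never move alone. -/
theorem run_of_run_par_loop {L : LTS.{u}} {a : Label.{u}} (ha : a ∈ L.alphabet)
    {σ : List Label.{u}} {x : (L.par (loop a)).State} (h : (L.par (loop a)).Run σ x) :
    L.Run σ x.1 := by
  induction h with
  | init => exact Run.init
  | tau _ h ih =>
    rcases h with ⟨-, h, -⟩ | ⟨-, h, -⟩ | ⟨-, -, h, -⟩
    · exact ih.tau h
    · cases h
    · exact ih.tau h
  | vis _ h ih =>
    rcases h with ⟨-, h, -⟩ | ⟨hn, h, -⟩ | ⟨-, -, h, -⟩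
    · exact ih.vis h
    · exact (hn ⟨a, ha, h.symm⟩).elim
    · exact ih.vis h

/-- If `a` were missing from `L'`, the loop could do `a` alone beside `L'`; that trace would pass to
`L` beside the loop, then to `L`, and back to `L'`. -/
theorem Preserves.alphabet_subset {R : LTS.{u} → LTS.{u} → Prop} (hR : IsCongruence R)
    (hSf : Preserves R Sf) (hDiv : Preserves R Div) {L L' : LTS.{u}} (h : R L L') :
    L.alphabet ⊆ L'.alphabet := by
  intro a ha
  by_contra ha'
  have hrun : (L'.par (loop a)).Run ([] ++ [a]) (L'.init, PUnit.unit) := by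
    refine Run.init.vis (Or.inr (Or.inl ⟨?_, rfl, rfl⟩))
    rintro ⟨b, hb, hab⟩
    exact ha' (Option.some.inj hab ▸ hb)
  have hp := hR.equivalence.symm (hR.par_right h (loop a))
  obtain ⟨x, hx⟩ := hrun.transfer (hSf _ _ hp) (hDiv _ _ hp)
  obtain ⟨s, hs⟩ := (run_of_run_par_loop ha hx).transfer (hSf _ _ h) (hDiv _ _ h)
  exact ha' (hs.mem_alphabet (by simp))

theorem Preserves.alphabet {R : LTS.{u} → LTS.{u} → Prop} (hR : IsCongruence R)
    (hSf : Preserves R Sf) (hDiv : Preserves R Div) : Preserves R alphabet := fun _ _ h =>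
  (Preserves.alphabet_subset hR hSf hDiv h).antisymm
    (Preserves.alphabet_subset hR hSf hDiv (hR.equivalence.symm h))

/-! ### A congruence that preserves `Sf` and `Div` preserves `eanI` -/

/-- The system over `B ∪ {c}` that executes `ξ` and inserts one `c` after at least `n` labels. -/
def monitor (B : Set Label.{u}) (hB : Small.{u} B) (c : Label.{u}) (ξ : ℕ → Label.{u})
    (hξ : ∀ i, ξ i ∈ B) (n : ℕ) : LTS.{u} where
  State := ULift.{u} (ℕ × Bool)
  alphabet := B ∪ {c}
  small_alphabet := small_union _ _
  trans := fun s x t =>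
    (x = some (ξ s.down.1) ∧ t.down = (s.down.1 + 1, s.down.2)) ∨
      (x = some c ∧ n ≤ s.down.1 ∧ s.down.2 = false ∧ t.down = (s.down.1, true))
  mem_alphabet := by
    rintro s x t (⟨h, -⟩ | ⟨h, -⟩)
    · exact Or.inl (Option.some.inj h ▸ hξ _)
    · exact Or.inr (Option.some.inj h)
  init := ⟨(0, false)⟩

/-- `L` is made to follow the monitor, and everything but `c` is hidden. -/
def monitored (L : LTS.{u}) (c : Label.{u}) (ξ : ℕ → Label.{u})
    (hξ : ∀ i, ξ i ∈ L.alphabet) (n : ℕ) : LTS.{u} :=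
  (L.par (monitor L.alphabet L.small_alphabet c ξ hξ n)).hide L.alphabet

section Monitored

variable {L : LTS.{u}} {c : Label.{u}} {ξ : ℕ → Label.{u}} {hξ : ∀ i, ξ i ∈ L.alphabet} {n : ℕ}

theorem monitored_trans_none {s t : L.State} {x y : ℕ × Bool} (hc : c ∉ L.alphabet) :
    (L.monitored c ξ hξ n).trans (s, ⟨x⟩) none (t, ⟨y⟩) ↔
      (L.trans s none t ∧ y = x) ∨ (L.trans s (some (ξ x.1)) t ∧ y = (x.1 + 1, x.2)) := by
  constructor
  · rintro ⟨b, h, ⟨rfl, hb⟩ | ⟨-, b, hb, rfl⟩⟩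
    · rcases h with ⟨-, h, e⟩ | ⟨-, h, -⟩ | ⟨⟨_, _, h⟩, -⟩
      · exact Or.inl ⟨h, congrArg ULift.down e⟩
      · rcases h with ⟨h, -⟩ | ⟨h, -⟩ <;> cases h
      · cases h
    · rcases h with ⟨hn, -, -⟩ | ⟨hn, -, -⟩ | ⟨-, -, h₁, h₂⟩
      · exact (hn ⟨b, Or.inl hb, rfl⟩).elim
      · exact (hn ⟨b, hb, rfl⟩).elim
      · rcases h₂ with ⟨h, e⟩ | ⟨h, -⟩
        · exact Or.inr ⟨h ▸ h₁, e⟩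
        · exact (hc (Option.some.inj h ▸ hb)).elim
  · rintro (⟨h, rfl⟩ | ⟨h, rfl⟩)
    · exact ⟨none, Or.inl ⟨by simp, h, rfl⟩, Or.inl ⟨rfl, by simp⟩⟩
    · exact ⟨some (ξ x.1), Or.inr (Or.inr ⟨⟨_, hξ _, rfl⟩, ⟨_, Or.inl (hξ _), rfl⟩, h,
        Or.inl ⟨rfl, rfl⟩⟩), Or.inr ⟨rfl, _, hξ _, rfl⟩⟩

theorem monitored_trans_some {s t : L.State} {x y : ℕ × Bool} {b : Label.{u}}
    (hc : c ∉ L.alphabet) :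
    (L.monitored c ξ hξ n).trans (s, ⟨x⟩) (some b) (t, ⟨y⟩) ↔
      b = c ∧ t = s ∧ n ≤ x.1 ∧ x.2 = false ∧ y = (x.1, true) := by
  constructor
  · rintro ⟨b, h, ⟨rfl, hb⟩ | ⟨h, -⟩⟩
    · rcases h with ⟨hn, h, -⟩ | ⟨-, h, e⟩ | ⟨-, -, h, -⟩
      · exact (hb ⟨_, L.mem_alphabet h, rfl⟩).elim
      · rcases h with ⟨h, -⟩ | ⟨h, h₁, h₂, h₃⟩
        · exact (hb ⟨_, hξ _, h.symm⟩).elim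
        · exact ⟨Option.some.inj h, e, h₁, h₂, h₃⟩
      · exact (hb ⟨_, L.mem_alphabet h, rfl⟩).elim
    · cases h
  · rintro ⟨rfl, rfl, h₁, h₂, rfl⟩
    have hb : some b ∉ some '' L.alphabet := by simpa using hc
    exact ⟨some b, Or.inr (Or.inl ⟨hb, Or.inr ⟨rfl, h₁, h₂, rfl⟩, rfl⟩), Or.inl ⟨rfl, hb⟩⟩

theorem run_of_run_monitored (hc : c ∉ L.alphabet) {σ : List Label.{u}}
    {x : (L.monitored c ξ hξ n).State} (h : (L.monitored c ξ hξ n).Run σ x) :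
    L.Run (prefixOf ξ x.2.down.1) x.1 ∧ (x.2.down.2 = false → σ = []) ∧
      (x.2.down.2 = true → n ≤ x.2.down.1) := by
  induction h with
  | init => exact ⟨Run.init, fun _ => rfl, fun h => by cases h⟩
  | @tau σ x y _ h ih =>
    obtain ⟨s, ⟨i, b⟩⟩ := x
    obtain ⟨t, ⟨j, d⟩⟩ := y
    rcases (monitored_trans_none hc).1 h with ⟨h', e⟩ | ⟨h', e⟩ <;> obtain ⟨rfl, rfl⟩ := Prod.mk.inj e
    · exact ⟨ih.1.tau h', ih.2⟩
    · exact ⟨prefixOf_succ ξ i ▸ ih.1.vis h', ih.2.1, fun h => (ih.2.2 h).trans (Nat.le_succ _)⟩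
  | @vis σ x y a _ h ih =>
    obtain ⟨s, ⟨i, b⟩⟩ := x
    obtain ⟨t, ⟨j, d⟩⟩ := y
    obtain ⟨-, rfl, h₁, h₂, e⟩ := (monitored_trans_some hc).1 h
    obtain ⟨rfl, rfl⟩ := Prod.mk.inj e
    exact ⟨ih.1, fun h => Bool.noConfusion h, fun _ => h₁⟩

theorem run_monitored {s : L.State} {i : ℕ} (hc : c ∉ L.alphabet)
    (h : L.Run (prefixOf ξ i) s) : (L.monitored c ξ hξ n).Run [] (s, ⟨(i, false)⟩) := by
  generalize hσ : prefixOf ξ i = σ at h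
  induction h generalizing i with
  | init =>
    obtain rfl : i = 0 := by simpa using congrArg List.length hσ
    exact Run.init
  | tau _ h ih => exact (ih hσ).tau ((monitored_trans_none hc).2 (Or.inl ⟨h, rfl⟩))
  | vis _ h ih =>
    cases i with
    | zero => simp at hσ
    | succ i =>
      rw [prefixOf_succ] at hσ
      obtain ⟨h₁, h₂⟩ := List.append_inj' hσ rfl
      obtain rfl := List.singleton_injective h₂
      exact (ih h₁).tau ((monitored_trans_none hc).2 (Or.inr ⟨h, rfl⟩))

/-- After `c` is inserted at position `n`, the rest of `ξ` is executed invisibly. -/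
theorem mem_Div_monitored (hc : c ∉ L.alphabet) (h : ξ ∈ L.Inf) :
    [c] ∈ (L.monitored c ξ hξ n).Div := by
  obtain ⟨s, hs, hi⟩ := exists_run_of_mem_Inf h n
  refine mem_Div_iff.2 ⟨(s, ⟨(n, true)⟩), ?_, ?_⟩
  · exact (run_monitored hc hs).vis ((monitored_trans_some hc).2 ⟨rfl, rfl, le_rfl, rfl, rfl⟩)
  · refine Diverges.of_progress (L := L.monitored c ξ hξ n)
      (X := fun x => ∃ t i, x = (t, ⟨(i, true)⟩) ∧ L.InfPath (fun j => ξ (j + i)) t) ?_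
      ⟨s, n, rfl, hi⟩
    rintro _ ⟨t, i, rfl, ht⟩
    obtain ⟨t', v, h₁, h₂, h₃⟩ := ht.exists_step_shift
    refine ⟨(v, ⟨(i + 1, true)⟩), ?_, v, i + 1, rfl, h₃⟩
    refine Relation.TransGen.tail' (b := ((t', ⟨(i, true)⟩) : (L.monitored c ξ hξ n).State)) ?_
      ((monitored_trans_none hc).2 (Or.inr ⟨h₂, rfl⟩))
    exact h₁.lift (fun v => ((v, ⟨(i, true)⟩) : (L.monitored c ξ hξ n).State))
      (fun _ _ h => (monitored_trans_none hc).2 (Or.inl ⟨h, rfl⟩))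

/-- Past position `n` the system `L` cannot diverge alone, so an infinite invisible path of the
composition executes infinitely many labels of `ξ`. -/
theorem mem_Inf_of_mem_Div_monitored (hc : c ∉ L.alphabet)
    (hn : ∀ i, n ≤ i → prefixOf ξ i ∉ L.Div) (h : [c] ∈ (L.monitored c ξ hξ n).Div) :
    ξ ∈ L.Inf := by
  obtain ⟨⟨s, ⟨i, b⟩⟩, hr, hd⟩ := mem_Div_iff.1 h
  obtain ⟨h₁, h₂, h₃⟩ := run_of_run_monitored hc hr
  obtain rfl : b = true := by
    cases b
    · exact absurd (h₂ rfl) (by simp)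
    · rfl
  have hi : n ≤ i := h₃ rfl
  refine Run.mem_Inf h₁ (InfPath.of_progress (X := fun m v => L.Run (prefixOf ξ (m + i)) v ∧
    (L.monitored c ξ hξ n).Diverges (v, ⟨(m + i, true)⟩)) ?_ ⟨by simpa using h₁, by simpa using hd⟩)
  rintro m v ⟨hv, hdv⟩
  -- Accessibility bounds the invisible steps of `L` before its next label of `ξ`.
  have hacc := not_diverges_iff_acc.1
    fun h => hn (m + i) (by omega) (mem_Div_iff.2 ⟨v, hv, h⟩)
  clear hr hd h₁ h₂ h₃ h
  induction hacc with
  | intro v _ ih =>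
    obtain ⟨p, hp₀, hp⟩ := hdv
    have hstep := hp 0
    rw [hp₀] at hstep
    have hrest : (L.monitored c ξ hξ n).Diverges (p 1) :=
      ⟨fun i => p (i + 1), rfl, fun i => hp (i + 1)⟩
    generalize p (0 + 1) = y at hstep hrest
    obtain ⟨t, ⟨y⟩⟩ := y
    rcases (monitored_trans_none hc).1 hstep with ⟨h, rfl⟩ | ⟨h, rfl⟩
    · obtain ⟨s', w, h₁, h₂, h₃⟩ := ih t h (hv.tau h) hrest
      exact ⟨s', w, Relation.ReflTransGen.head h h₁, h₂, h₃⟩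
    · refine ⟨v, t, Relation.ReflTransGen.refl, h, ?_, ?_⟩
      · rw [show m + 1 + i = (m + i) + 1 by omega, prefixOf_succ]
        exact hv.vis h
      · rwa [show m + 1 + i = (m + i) + 1 by omega]

end Monitored

theorem Preserves.eanI_subset {R : LTS.{u} → LTS.{u} → Prop} (hR : IsCongruence R)
    (hSf : Preserves R Sf) (hDiv : Preserves R Div) {L L' : LTS.{u}} (h : R L L') :
    L.eanI ⊆ L'.eanI := by
  rintro ξ ⟨hξ, n, hn⟩
  have hD : L.Div = L'.Div := hDiv _ _ h
  have hA : L.alphabet = L'.alphabet := Preserves.alphabet hR hSf hDiv _ _ h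
  rw [hD] at hn
  refine ⟨?_, n, hn⟩
  obtain ⟨c, hc⟩ := exists_label_notMem L.alphabet L.small_alphabet
  have hξL := mem_alphabet_of_mem_Inf hξ
  have hξL' : ∀ i, ξ i ∈ L'.alphabet := hA ▸ hξL
  refine mem_Inf_of_mem_Div_monitored (hξ := hξL') (hA ▸ hc) hn ?_
  have hm : R (L.monitored c ξ hξL n) (L'.monitored c ξ hξL' n) := by
    have hM : monitor L.alphabet L.small_alphabet c ξ hξL n =
        monitor L'.alphabet L'.small_alphabet c ξ hξL' n := by
      congr 1
    unfold monitored
    rw [← hM, ← hA]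
    exact hR.hide (hR.par_right h _) _
  rw [← hDiv _ _ hm]
  exact mem_Div_monitored hc hξ

theorem Preserves.eanI {R : LTS.{u} → LTS.{u} → Prop} (hR : IsCongruence R)
    (hSf : Preserves R Sf) (hDiv : Preserves R Div) : Preserves R eanI := fun _ _ h =>
  (Preserves.eanI_subset hR hSf hDiv h).antisymm
    (Preserves.eanI_subset hR hSf hDiv (hR.equivalence.symm h))

/-! ### A one-letter witness that `aenI` is not preserved -/

/-- The system over `B` that executes `ξ`. -/
def line (B : Set Label.{u}) (hB : Small.{u} B) (ξ : ℕ → Label.{u}) (hξ : ∀ i, ξ i ∈ B) :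
    LTS.{u} where
  State := ULift.{u} ℕ
  alphabet := B
  small_alphabet := hB
  trans := fun s x t => x = some (ξ s.down) ∧ t.down = s.down + 1
  mem_alphabet := by
    rintro s x t ⟨h, -⟩
    exact Option.some.inj h ▸ hξ _
  init := ⟨0⟩

theorem small_prod_singleton (B : Set Label.{u}) (hB : Small.{u} B) (a : Label.{u}) :
    Small.{u} (B ×ˢ {a} : Set (Label.{u} × Label.{u})) := by
  have : (B ×ˢ {a} : Set (Label.{u} × Label.{u})) = (fun b => (b, a)) '' B := by
    ext ⟨x, y⟩
    simp [eq_comm]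
  rw [this]
  infer_instance

/-- `L` is made to follow `ξ`, every label is renamed to `a`, and an `a` is added in front. -/
def counted (L : LTS.{u}) (a : Label.{u}) (ξ : ℕ → Label.{u}) (hξ : ∀ i, ξ i ∈ L.alphabet) :
    LTS.{u} :=
  ((L.par (line L.alphabet L.small_alphabet ξ hξ)).rename (L.alphabet ×ˢ {a})
    (small_prod_singleton _ L.small_alphabet a)).pre a

section Counted

variable {L : LTS.{u}} {a : Label.{u}} {ξ : ℕ → Label.{u}} {hξ : ∀ i, ξ i ∈ L.alphabet}

theorem renLabel_prod_iff {B : Set Label.{u}} {x b : Label.{u}} (hx : x ∈ B) :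
    RenLabel (B ×ˢ {a}) x b ↔ b = a := by
  constructor
  · rintro (⟨-, h⟩ | ⟨-, h⟩)
    · exact h
    · exact (h a ⟨hx, rfl⟩).elim
  · rintro rfl
    exact Or.inl ⟨hx, rfl⟩

theorem counted_alphabet : (L.counted a ξ hξ).alphabet = {a} := by
  ext b
  constructor
  · rintro (⟨x, hx, h⟩ | h)
    · exact (renLabel_prod_iff (hx.elim id id)).1 h
    · exact h
  · exact Or.inr

theorem line_par_trans {s t : L.State} {i j : ℕ} {x : Act.{u}} :
    (L.par (line L.alphabet L.small_alphabet ξ hξ)).trans (s, ⟨i⟩) x (t, ⟨j⟩) ↔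
      (x = none ∧ L.trans s none t ∧ j = i) ∨
        (x = some (ξ i) ∧ L.trans s (some (ξ i)) t ∧ j = i + 1) := by
  constructor
  · rintro (⟨hn, h, e⟩ | ⟨hn, ⟨h, -⟩, -⟩ | ⟨-, -, h₁, h₂, e⟩)
    · cases x with
      | none => exact Or.inl ⟨rfl, h, congrArg ULift.down e⟩
      | some x => exact (hn ⟨x, L.mem_alphabet h, rfl⟩).elim
    · exact (hn ⟨_, hξ _, h.symm⟩).elim
    · subst h₂
      exact Or.inr ⟨rfl, h₁, e⟩
  · rintro (⟨rfl, h, rfl⟩ | ⟨rfl, h, rfl⟩)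
    · exact Or.inl ⟨by simp, h, rfl⟩
    · exact Or.inr (Or.inr ⟨⟨_, hξ _, rfl⟩, ⟨_, hξ _, rfl⟩, h, rfl, rfl⟩)

theorem counted_trans_none {x y : Option (L.State × ULift.{u} ℕ)} :
    (L.counted a ξ hξ).trans x none y ↔
      ∃ s t i, x = some (s, ⟨i⟩) ∧ y = some (t, ⟨i⟩) ∧ L.trans s none t := by
  constructor
  · rintro (⟨⟨s, ⟨i⟩⟩, ⟨t, ⟨j⟩⟩, rfl, rfl, z, h, hz⟩ | ⟨-, h, -⟩)
    · rcases line_par_trans.1 h with ⟨-, h', rfl⟩ | ⟨rfl, -, -⟩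
      · exact ⟨s, t, j, rfl, rfl, h'⟩
      · exact hz.elim
    · cases h
  · rintro ⟨s, t, i, rfl, rfl, h⟩
    exact Or.inl ⟨(s, ⟨i⟩), (t, ⟨i⟩), rfl, rfl, none, line_par_trans.2 (Or.inl ⟨rfl, h, rfl⟩),
      trivial⟩

theorem counted_trans_some {x y : Option (L.State × ULift.{u} ℕ)} {b : Label.{u}} :
    (L.counted a ξ hξ).trans x (some b) y ↔ b = a ∧ ((x = none ∧ y = some (L.init, ⟨0⟩)) ∨
      ∃ s t i, x = some (s, ⟨i⟩) ∧ y = some (t, ⟨i + 1⟩) ∧ L.trans s (some (ξ i)) t) := by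
  constructor
  · rintro (⟨⟨s, ⟨i⟩⟩, ⟨t, ⟨j⟩⟩, rfl, rfl, z, h, hz⟩ | ⟨rfl, h, rfl⟩)
    · rcases line_par_trans.1 h with ⟨rfl, -, -⟩ | ⟨rfl, h', rfl⟩
      · exact hz.elim
      · exact ⟨(renLabel_prod_iff (hξ i)).1 hz, Or.inr ⟨s, t, i, rfl, rfl, h'⟩⟩
    · exact ⟨Option.some.inj h, Or.inl ⟨rfl, rfl⟩⟩
  · rintro ⟨rfl, ⟨rfl, rfl⟩ | ⟨s, t, i, rfl, rfl, h⟩⟩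
    · exact Or.inr ⟨rfl, rfl, rfl⟩
    · exact Or.inl ⟨(s, ⟨i⟩), (t, ⟨i + 1⟩), rfl, rfl, some (ξ i),
        line_par_trans.2 (Or.inr ⟨rfl, h, rfl⟩), (renLabel_prod_iff (hξ i)).2 rfl⟩

theorem counted_init_not_tau (x : Option (L.State × ULift.{u} ℕ)) :
    ¬ (L.counted a ξ hξ).trans (L.counted a ξ hξ).init none x := fun h => by
  obtain ⟨s, t, i, h, -⟩ := counted_trans_none.1 h
  cases h

theorem run_of_run_counted {σ : List Label.{u}} {x : (L.counted a ξ hξ).State}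
    (h : (L.counted a ξ hξ).Run σ x) : (x = (none : Option (L.State × ULift.{u} ℕ)) ∧ σ = []) ∨
      ∃ s i, x = some (s, ⟨i⟩) ∧ σ = List.replicate (i + 1) a ∧ L.Run (prefixOf ξ i) s := by
  induction h with
  | init => exact Or.inl ⟨rfl, rfl⟩
  | tau _ h ih =>
    obtain ⟨s, t, i, rfl, rfl, h'⟩ := counted_trans_none.1 h
    rcases ih with ⟨ih, -⟩ | ⟨s', i', e, hσ, ih⟩
    · cases ih
    · cases e
      exact Or.inr ⟨t, i, rfl, hσ, ih.tau h'⟩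
  | vis _ h ih =>
    obtain ⟨rfl, ⟨rfl, rfl⟩ | ⟨s, t, i, rfl, rfl, h'⟩⟩ := counted_trans_some.1 h
    · rcases ih with ⟨-, rfl⟩ | ⟨s', i', e, -⟩
      · exact Or.inr ⟨_, 0, rfl, rfl, Run.init⟩
      · cases e
    · rcases ih with ⟨ih, -⟩ | ⟨s', i', e, rfl, ih⟩
      · cases ih
      · cases e
        exact Or.inr ⟨t, i + 1, rfl, List.replicate_succ'.symm, prefixOf_succ ξ i ▸ ih.vis h'⟩

/-- One `a` comes from the prefix operator and `n` from `ξ`; the line has no invisible steps, so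
only `L` can diverge. -/
theorem mem_Div_of_mem_Div_counted {n : ℕ}
    (h : List.replicate (n + 1) a ∈ (L.counted a ξ hξ).Div) : prefixOf ξ n ∈ L.Div := by
  obtain ⟨x, hx, hd⟩ := mem_Div_iff.1 h
  rcases run_of_run_counted hx with ⟨-, h⟩ | ⟨s, i, rfl, h, hr⟩
  · simp at h
  · obtain rfl : n = i := by simpa using congrArg List.length h
    refine mem_Div_iff.2 ⟨s, hr, Diverges.of_progress
      (X := fun t => (L.counted a ξ hξ).Diverges (some (t, ⟨n⟩))) ?_ hd⟩
    rintro t ⟨p, hp₀, hp⟩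
    have hstep := hp 0
    rw [hp₀] at hstep
    obtain ⟨s', t', i, h₁, h₂, h'⟩ := counted_trans_none.1 hstep
    cases h₁
    exact ⟨t', Relation.TransGen.single h', fun i => p (i + 1), h₂, fun i => hp (i + 1)⟩

theorem mem_Inf_counted (h : ξ ∈ L.Inf) : (fun _ => a) ∈ (L.counted a ξ hξ).Inf := by
  refine InfPath.of_progress (L := L.counted a ξ hξ)
    (X := fun n x => (n = 0 ∧ x = (L.counted a ξ hξ).init) ∨ ∃ m s, n = m + 1 ∧
      x = some (s, ⟨m⟩) ∧ L.InfPath (fun i => ξ (i + m)) s) ?_ (Or.inl ⟨rfl, rfl⟩)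
  rintro _ _ (⟨rfl, rfl⟩ | ⟨m, s, rfl, rfl, hs⟩)
  · exact ⟨none, some (L.init, ⟨0⟩), Relation.ReflTransGen.refl,
      counted_trans_some.2 ⟨rfl, Or.inl ⟨rfl, rfl⟩⟩, Or.inr ⟨0, L.init, rfl, rfl, h⟩⟩
  · obtain ⟨s', t, h₁, h₂, h₃⟩ := hs.exists_step_shift
    refine ⟨some (s', ⟨m⟩), some (t, ⟨m + 1⟩), ?_,
      counted_trans_some.2 ⟨rfl, Or.inr ⟨s', t, m, rfl, rfl, h₂⟩⟩,
      Or.inr ⟨m + 1, t, rfl, rfl, h₃⟩⟩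
    exact h₁.lift (fun v => (some (v, ⟨m⟩) : (L.counted a ξ hξ).State))
      (fun v w h => counted_trans_none.2 ⟨v, w, m, rfl, rfl, h⟩)

theorem tauStar_of_tauStar_counted {x y : (L.counted a ξ hξ).State}
    (h : (L.counted a ξ hξ).TauStar x y) : y = x ∨
      ∃ s t i, x = some (s, ⟨i⟩) ∧ y = some (t, ⟨i⟩) ∧ L.TauStar s t := by
  induction h with
  | refl => exact Or.inl rfl
  | tail _ h ih =>
    obtain ⟨s, t, i, rfl, rfl, h'⟩ := counted_trans_none.1 h
    rcases ih with rfl | ⟨s', t', i', rfl, e, ih⟩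
    · exact Or.inr ⟨s, t, i, rfl, rfl, Relation.ReflTransGen.single h'⟩
    · cases e
      exact Or.inr ⟨s', t, i, rfl, rfl, ih.tail h'⟩

/-- The renaming loses nothing: the line remembers which label each `a` stands for. -/
theorem mem_Inf_of_mem_Inf_counted (h : (fun _ => a) ∈ (L.counted a ξ hξ).Inf) : ξ ∈ L.Inf := by
  obtain ⟨x, y, h₁, h₂, h₃⟩ := InfPath.exists_step h
  have hy : y = some (L.init, ⟨0⟩) := by
    rcases tauStar_of_tauStar_counted h₁ with rfl | ⟨s, t, i, e, -⟩
    · obtain ⟨-, ⟨-, h⟩ | ⟨s, t, i, e, -⟩⟩ := counted_trans_some.1 h₂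
      · exact h
      · cases e
    · cases e
  subst hy
  refine InfPath.of_progress
    (X := fun n s => (L.counted a ξ hξ).InfPath (fun _ => a) (some (s, ⟨n⟩))) ?_ h₃
  intro n s hs
  obtain ⟨x, y, h₁, h₂, h₃⟩ := hs.exists_step
  obtain ⟨s', rfl, hs'⟩ : ∃ s', x = some (s', ⟨n⟩) ∧ L.TauStar s s' := by
    rcases tauStar_of_tauStar_counted h₁ with rfl | ⟨s₁, t, i, e, rfl, h⟩
    · exact ⟨s, rfl, Relation.ReflTransGen.refl⟩
    · cases e
      exact ⟨t, rfl, h⟩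
  obtain ⟨-, ⟨e, -⟩ | ⟨v, t, i, e, rfl, h⟩⟩ := counted_trans_some.1 h₂
  · cases e
  · cases e
    exact ⟨s', t, hs', h, h₃⟩

end Counted

/-- A counter over `{a}`: it starts without an invisible transition, and it does not diverge
after `j` executions of `a` unless `j ∈ D`. -/
structure IsCounter (G : LTS.{u}) (a : Label.{u}) (D : Set ℕ) : Prop where
  alphabet : G.alphabet = {a}
  init_not_tau : ∀ t, ¬ G.trans G.init none t
  notMem_Div : ∀ j, j ∉ D → List.replicate j a ∉ G.Div

/-- Since `Div` agrees on the separating pair, its trace `ξ` can leave `aenI` only by leaving `Inf`.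
The added first `a` makes the initial state stable, whence `0 ∉ D`. -/
theorem exists_counters {R : LTS.{u} → LTS.{u} → Prop} (hR : IsCongruence R)
    (hSf : Preserves R Sf) (hDiv : Preserves R Div) (haenI : ¬ Preserves R aenI)
    (a : Label.{u}) : ∃ (G₁ G₂ : LTS.{u}) (D : Set ℕ), R G₁ G₂ ∧ G₁.IsCounter a D ∧
      G₂.IsCounter a D ∧ 0 ∉ D ∧ (∀ n, ∃ j, n ≤ j ∧ j ∉ D) ∧
      (fun _ => a) ∈ G₁.Inf ∧ (fun _ => a) ∉ G₂.Inf := by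
  obtain ⟨L₁, L₂, hL, ξ, h₁, h₂⟩ : ∃ L₁ L₂ : LTS.{u}, R L₁ L₂ ∧ ∃ ξ, ξ ∈ L₁.aenI ∧
      ξ ∉ L₂.aenI := by
    by_contra! h
    exact haenI fun L L' hL => Set.Subset.antisymm (fun ξ => h L L' hL ξ)
      fun ξ => h L' L (hR.equivalence.symm hL) ξ
  have hD : L₁.Div = L₂.Div := hDiv _ _ hL
  have hA : L₁.alphabet = L₂.alphabet := Preserves.alphabet hR hSf hDiv _ _ hL
  have hξ₁ := mem_alphabet_of_mem_Inf h₁.1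
  have hξ₂ : ∀ i, ξ i ∈ L₂.alphabet := hA ▸ hξ₁
  have hG : R (L₁.counted a ξ hξ₁) (L₂.counted a ξ hξ₂) := by
    have hM : line L₁.alphabet L₁.small_alphabet ξ hξ₁ =
        line L₂.alphabet L₂.small_alphabet ξ hξ₂ := by
      congr 1
    have h := hR.pre (hR.rename (hR.par_right hL (line L₁.alphabet L₁.small_alphabet ξ hξ₁))
      (L₁.alphabet ×ˢ {a}) (small_prod_singleton _ L₁.small_alphabet a)) a
    unfold counted
    convert h using 4
    · exact hM.symm
    · exact hA.symm
  refine ⟨_, _, {j | List.replicate j a ∈ (L₁.counted a ξ hξ₁).Div}, hG,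
    ⟨counted_alphabet, counted_init_not_tau, fun j hj => hj⟩,
    ⟨counted_alphabet, counted_init_not_tau, fun j hj => hDiv _ _ hG ▸ hj⟩, fun h => ?_,
    fun n => ?_, mem_Inf_counted h₁.1, fun h => h₂ ⟨mem_Inf_of_mem_Inf_counted h, hD ▸ h₁.2⟩⟩
  · obtain ⟨x, hx, p, hp₀, hp⟩ := mem_Div_iff.1 h
    rcases run_of_run_counted hx with ⟨rfl, -⟩ | ⟨_, _, -, h, -⟩
    · exact counted_init_not_tau _ (hp₀ ▸ hp 0)
    · cases h
  · obtain ⟨i, hi, hn⟩ := h₁.2 n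
    exact ⟨i + 1, by omega, fun h => hn (mem_Div_of_mem_Div_counted h)⟩

/-! ### Adding infinite traces by means of a counter -/

/-- The states of `tracker`: the initial state, the states of the tracked system, and the states
`track ξ k j p`, where `k` labels of `ξ` and `j` ticks have been executed and `p` tells that a tick
must come next. -/
inductive TrackState (S Ξ : Type u) : Type u
  | start
  | base (s : S)
  | track (ξ : Ξ) (k j : ℕ) (p : Prop)

/-- The transitions of `tracker`. -/
inductive TrackTrans (L : LTS.{u}) {Ξ : Type u} (f : Ξ → ℕ → Label.{u}) (a : Label.{u})
    (D : Set ℕ) : TrackState L.State Ξ → Act.{u} → TrackState L.State Ξ → Prop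
  | enterBase : TrackTrans L f a D .start none (.base L.init)
  | enterTrack (ξ) : TrackTrans L f a D .start none (.track ξ 0 0 ([] ∈ L.Div))
  | base {s x t} : L.trans s x t → TrackTrans L f a D (.base s) x (.base t)
  -- Together, `loop` and `exit` leave no reachable tracking state stable.
  | loop {ξ k j p} : prefixOf (f ξ) k ∈ L.Div →
      TrackTrans L f a D (.track ξ k j p) none (.track ξ k j p)
  | exit {ξ k j p s} : ¬ p → j ∉ D → L.Run (prefixOf (f ξ) k) s →
      TrackTrans L f a D (.track ξ k j p) none (.base s)
  | tick {ξ k j p} : p ∨ j ∈ D →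
      TrackTrans L f a D (.track ξ k j p) (some a) (.track ξ k (j + 1) False)
  | step {ξ k j p} : ¬ p → j ∉ D → TrackTrans L f a D (.track ξ k j p) (some (f ξ k))
      (.track ξ (k + 1) j (prefixOf (f ξ) (k + 1) ∈ L.Div))

/-- The system that behaves like `L` or executes some `f ξ`, with ticks `a` where `f ξ` reaches a
divergence trace of `L`. -/
def tracker (L : LTS.{u}) {Ξ : Type u} (f : Ξ → ℕ → Label.{u}) (hf : ∀ ξ k, f ξ k ∈ L.alphabet)
    (a : Label.{u}) (D : Set ℕ) : LTS.{u} where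
  State := TrackState L.State Ξ
  alphabet := L.alphabet ∪ {a}
  small_alphabet := by
    have := L.small_alphabet
    exact small_union _ _
  trans := TrackTrans L f a D
  mem_alphabet := by
    intro s b t h
    generalize hx : (some b : Act.{u}) = x at h
    cases h <;> cases hx
    · exact Or.inl (L.mem_alphabet ‹_›)
    · exact Or.inr rfl
    · exact Or.inl (hf _ _)
  init := .start

/-- The tracker, controlled by a counter of ticks. -/
def tracked (L : LTS.{u}) {Ξ : Type u} (f : Ξ → ℕ → Label.{u}) (hf : ∀ ξ k, f ξ k ∈ L.alphabet)
    (a : Label.{u}) (D : Set ℕ) (G : LTS.{u}) : LTS.{u} :=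
  ((L.tracker f hf a D).par G).hide {a}

section Tracked

variable {L : LTS.{u}} {Ξ : Type u} {f : Ξ → ℕ → Label.{u}} {hf : ∀ ξ k, f ξ k ∈ L.alphabet}
  {a : Label.{u}} {D : Set ℕ} {G : LTS.{u}}

theorem tracked_alphabet (hG : G.alphabet = {a}) (ha : a ∉ L.alphabet) :
    (L.tracked f hf a D G).alphabet = L.alphabet := by
  ext b
  have hab : b ∈ L.alphabet → b ≠ a := fun hb h => ha (h ▸ hb)
  change ((b ∈ L.alphabet ∨ b = a) ∨ b ∈ G.alphabet) ∧ ¬ b = a ↔ b ∈ L.alphabet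
  rw [hG, Set.mem_singleton_iff]
  tauto

theorem tracked_trans_none (hG : G.alphabet = {a}) {x y : TrackState L.State Ξ}
    {g g' : G.State} : (L.tracked f hf a D G).trans (x, g) none (y, g') ↔
      (TrackTrans L f a D x none y ∧ g' = g) ∨ (G.trans g none g' ∧ y = x) ∨
        (TrackTrans L f a D x (some a) y ∧ G.trans g (some a) g') := by
  constructor
  · rintro ⟨b, h, ⟨rfl, -⟩ | ⟨-, _, rfl, rfl⟩⟩
    · rcases h with h | h | ⟨⟨_, _, h⟩, -⟩
      · exact Or.inl h.2
      · exact Or.inr (Or.inl h.2)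
      · cases h
    · rcases h with ⟨hn, -⟩ | ⟨hn, -⟩ | h
      · exact (hn ⟨_, hG ▸ rfl, rfl⟩).elim
      · exact (hn ⟨_, Or.inr rfl, rfl⟩).elim
      · exact Or.inr (Or.inr h.2.2)
  · rintro (h | h | h)
    · exact ⟨none, Or.inl ⟨by simp, h⟩, Or.inl ⟨rfl, by simp⟩⟩
    · exact ⟨none, Or.inr (Or.inl ⟨by simp, h⟩), Or.inl ⟨rfl, by simp⟩⟩
    · exact ⟨some a, Or.inr (Or.inr ⟨⟨a, Or.inr rfl, rfl⟩, ⟨a, hG ▸ rfl, rfl⟩, h⟩),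
        Or.inr ⟨rfl, a, rfl, rfl⟩⟩

theorem tracked_trans_some (hG : G.alphabet = {a}) {x y : TrackState L.State Ξ}
    {g g' : G.State} {b : Label.{u}} : (L.tracked f hf a D G).trans (x, g) (some b) (y, g') ↔
      b ≠ a ∧ TrackTrans L f a D x (some b) y ∧ g' = g := by
  constructor
  · rintro ⟨_, h, ⟨rfl, hb⟩ | ⟨h, -⟩⟩
    · have hba : b ≠ a := fun h => hb ⟨a, rfl, h ▸ rfl⟩
      rcases h with h | ⟨-, h, -⟩ | ⟨-, -, -, h⟩
      · exact ⟨hba, h.2⟩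
      · exact (hba (by simpa [hG] using G.mem_alphabet h)).elim
      · exact (hba (by simpa [hG] using G.mem_alphabet h)).elim
    · cases h
  · rintro ⟨hb, h⟩
    exact ⟨some b, Or.inl ⟨by simpa [hG] using hb, h⟩, Or.inl ⟨rfl, by simpa using hb⟩⟩

/-- What is known about a state of `tracked` that is reached with trace `σ`. -/
def TrackInv (L : LTS.{u}) (f : Ξ → ℕ → Label.{u}) (a : Label.{u}) (D : Set ℕ) (G : LTS.{u})
    (σ : List Label.{u}) : TrackState L.State Ξ → G.State → Prop
  | .start, g => σ = [] ∧ G.Run [] g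
  | .base s, g => L.Run σ s ∧ ∃ j, j ∉ D ∧ G.Run (List.replicate j a) g
  | .track ξ k j p, g => σ = prefixOf (f ξ) k ∧ G.Run (List.replicate j a) g ∧
      (p ∨ j ∈ D → σ ∈ L.Div)

/-- A label of `f ξ` is executed only when `j ∉ D`, and the new `p` says that the new trace is in
`L.Div`. Ticks leave the trace unchanged, so whenever a tick is due the trace is already divergent.
-/
theorem trackInv_of_run (hG : G.alphabet = {a}) (ha : a ∉ L.alphabet) (h0 : 0 ∉ D)
    {σ : List Label.{u}} {x : (L.tracked f hf a D G).State}
    (h : (L.tracked f hf a D G).Run σ x) : TrackInv L f a D G σ x.1 x.2 := by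
  induction h with
  | init => exact ⟨rfl, Run.init⟩
  | @tau σ x y _ htr ih =>
    obtain ⟨x, g⟩ := x
    obtain ⟨y, g'⟩ := y
    rcases (tracked_trans_none hG).1 htr with ⟨h', rfl⟩ | ⟨h', rfl⟩ | ⟨h₁, h₂⟩
    · cases h' with
      | enterBase => exact ⟨ih.1 ▸ Run.init, 0, h0, ih.2⟩
      | enterTrack ξ => exact ⟨ih.1, ih.2, fun h => h.elim (ih.1 ▸ ·) fun h => (h0 h).elim⟩
      | base h => exact ⟨ih.1.tau h, ih.2⟩
      | loop h => exact ih
      | exit _ hj hs => exact ⟨ih.1 ▸ hs, _, hj, ih.2.1⟩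
    · cases y with
      | start => exact ⟨ih.1, ih.2.tau h'⟩
      | base s => exact ⟨ih.1, ih.2.imp fun j hj => ⟨hj.1, hj.2.tau h'⟩⟩
      | track ξ k j p => exact ⟨ih.1, ih.2.1.tau h', ih.2.2⟩
    · generalize hz : (some a : Act.{u}) = z at h₁
      cases h₁ with
      | base h =>
        subst hz
        exact (ha (L.mem_alphabet h)).elim
      | tick hp =>
        exact ⟨ih.1, List.replicate_succ' ▸ ih.2.1.vis h₂, fun _ => ih.2.2 hp⟩
      | step => exact (ha (Option.some.inj hz ▸ hf _ _)).elim
      | _ => cases hz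
  | @vis σ x y b _ htr ih =>
    obtain ⟨x, g⟩ := x
    obtain ⟨y, g'⟩ := y
    obtain ⟨hb, h', rfl⟩ := (tracked_trans_some hG).1 htr
    generalize hz : (some b : Act.{u}) = z at h'
    cases h' with
    | base h =>
      subst hz
      exact ⟨ih.1.vis h, ih.2⟩
    | tick => exact (hb (Option.some.inj hz)).elim
    | @step ξ k j p hp hj =>
      obtain rfl := Option.some.inj hz
      have e : σ ++ [f ξ k] = prefixOf (f ξ) (k + 1) := by rw [prefixOf_succ, ih.1]
      exact ⟨e, ih.2.1, fun h => h.elim (e ▸ ·) fun h => (hj h).elim⟩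
    | _ => cases hz

theorem run_tracked_base (hG : G.alphabet = {a}) (ha : a ∉ L.alphabet) {σ : List Label.{u}}
    {s : L.State} (h : L.Run σ s) : (L.tracked f hf a D G).Run σ (.base s, G.init) := by
  induction h with
  | init => exact Run.init.tau ((tracked_trans_none hG).2 (Or.inl ⟨.enterBase, rfl⟩))
  | tau _ h ih => exact ih.tau ((tracked_trans_none hG).2 (Or.inl ⟨.base h, rfl⟩))
  | vis _ h ih =>
    exact ih.vis ((tracked_trans_some hG).2
      ⟨fun e => ha (e ▸ L.mem_alphabet h), .base h, rfl⟩)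

/-- On a trace outside `L.Div` the invariant excludes pending ticks and `j ∈ D`, so neither `L` nor
the counter diverges and no hidden tick is possible. -/
theorem Div_tracked (hG : G.IsCounter a D) (ha : a ∉ L.alphabet) (h0 : 0 ∉ D) :
    (L.tracked f hf a D G).Div = L.Div := by
  have hA := hG.alphabet
  ext σ
  constructor
  · intro h
    by_contra hσ
    obtain ⟨⟨x, g⟩, hr, hd⟩ := mem_Div_iff.1 h
    have hacc : ∀ {j} {g : G.State}, j ∉ D → G.Run (List.replicate j a) g →
        Acc (fun t s => G.trans s none t) g := fun hj hg => not_diverges_iff_acc.1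
      fun hd => hG.notMem_Div _ hj (mem_Div_iff.2 ⟨_, hg, hd⟩)
    have hbase : ∀ {s : L.State} {g : G.State} {j}, j ∉ D → G.Run (List.replicate j a) g →
        L.Run σ s → Acc (fun t s => (L.tracked f hf a D G).trans s none t)
          ((.base s, g) : (L.tracked f hf a D G).State) := by
      intro s g j hj hg hs
      have h₁ := not_diverges_iff_acc.1 fun h => hσ (mem_Div_iff.2 ⟨s, hs, h⟩)
      have h₂ := hacc hj hg
      clear hs hg
      -- Nested induction: each invisible step decreases either the state of `L` or that of the
      -- counter.
      induction h₁ generalizing g with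
      | intro s h₁ ih₁ =>
        induction h₂ with
        | intro g h₂ ih₂ =>
          refine Acc.intro _ ?_
          rintro ⟨y, g'⟩ htr
          rcases (tracked_trans_none hA).1 htr with ⟨h', rfl⟩ | ⟨h', rfl⟩ | ⟨h', -⟩
          · cases h' with
            | base h => exact ih₁ _ h (Acc.intro _ h₂)
          · exact ih₂ _ h'
          · cases h' with
            | base h => exact (ha (L.mem_alphabet h)).elim
    have htrack : ∀ {ξ k j p} {g : G.State}, ¬ p → j ∉ D → G.Run (List.replicate j a) g →
        σ = prefixOf (f ξ) k → Acc (fun t s => (L.tracked f hf a D G).trans s none t)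
          ((.track ξ k j p, g) : (L.tracked f hf a D G).State) := by
      intro ξ k j p g hp hj hg e
      have h₂ := hacc hj hg
      induction h₂ with
      | intro g h₂ ih₂ =>
        refine Acc.intro _ ?_
        rintro ⟨y, g'⟩ htr
        rcases (tracked_trans_none hA).1 htr with ⟨h', rfl⟩ | ⟨h', rfl⟩ | ⟨h', -⟩
        · cases h' with
          | loop h => exact (hσ (e ▸ h)).elim
          | exit _ _ hs => exact hbase hj hg (e ▸ hs)
        · exact ih₂ _ h' (hg.tau h')
        · generalize hz : (some a : Act.{u}) = z at h'
          cases h' with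
          | tick h => exact (h.elim hp hj).elim
          | step => exact (ha (Option.some.inj hz ▸ hf _ _)).elim
          | _ => cases hz
    have hstart : ∀ {g : G.State}, σ = [] → G.Run [] g →
        Acc (fun t s => (L.tracked f hf a D G).trans s none t)
          ((.start, g) : (L.tracked f hf a D G).State) := by
      intro g e hg
      have h₂ := hacc (j := 0) h0 hg
      induction h₂ with
      | intro g h₂ ih₂ =>
        refine Acc.intro _ ?_
        rintro ⟨y, g'⟩ htr
        rcases (tracked_trans_none hA).1 htr with ⟨h', rfl⟩ | ⟨h', rfl⟩ | ⟨h', -⟩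
        · cases h' with
          | enterBase => exact hbase (j := 0) h0 hg (e ▸ Run.init)
          | enterTrack ξ => exact htrack (fun h => hσ (e ▸ h)) h0 hg e
        · exact ih₂ _ h' (hg.tau h')
        · cases h'
    refine not_diverges_iff_acc.2 ?_ hd
    have hinv := trackInv_of_run hA ha h0 hr
    cases x with
    | start => exact hstart hinv.1 hinv.2
    | base s =>
      obtain ⟨hs, j, hj, hg⟩ := hinv
      exact hbase hj hg hs
    | track ξ k j p =>
      exact htrack (fun h => hσ (hinv.2.2 (Or.inl h))) (fun h => hσ (hinv.2.2 (Or.inr h)))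
        hinv.2.1 hinv.1
  · intro h
    obtain ⟨s, hs, p, rfl, hp⟩ := mem_Div_iff.1 h
    exact mem_Div_iff.2 ⟨_, run_tracked_base hA ha hs, fun i => (.base (p i), G.init), rfl,
      fun i => (tracked_trans_none hA).2 (Or.inl ⟨.base (hp i), rfl⟩)⟩

/-- Only base states can be stable, and they refuse what `L` refuses. Conversely, a failure of `L`
is realized beside the initial state of the counter, which has no invisible step. -/
theorem Sf_tracked (hG : G.IsCounter a D) (ha : a ∉ L.alphabet) (h0 : 0 ∉ D)
    (hrun : ∀ ξ k, ∃ s, L.Run (prefixOf (f ξ) k) s) : (L.tracked f hf a D G).Sf = L.Sf := by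
  have hA := hG.alphabet
  have hne : ∀ {s t : L.State} {b}, L.trans s (some b) t → b ≠ a :=
    fun h e => ha (e ▸ L.mem_alphabet h)
  ext ⟨σ, B⟩
  rw [mem_Sf_iff, mem_Sf_iff, tracked_alphabet hA ha]
  refine and_congr_right fun _ => ⟨?_, ?_⟩
  · rintro ⟨⟨x, g⟩, hr, hτ, hB⟩
    have hinv := trackInv_of_run hA ha h0 hr
    cases x with
    | start =>
      exact (hτ (.base L.init, g) ((tracked_trans_none hA).2 (Or.inl ⟨.enterBase, rfl⟩))).elim
    | base s =>
      refine ⟨s, hinv.1, fun t h => ?_, fun b hb t h => ?_⟩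
      · exact hτ (.base t, g) ((tracked_trans_none hA).2 (Or.inl ⟨.base h, rfl⟩))
      · exact hB b hb (.base t, g) ((tracked_trans_some hA).2 ⟨hne h, .base h, rfl⟩)
    | track ξ k j p =>
      exfalso
      obtain ⟨rfl, -, hp⟩ := hinv
      by_cases hd : prefixOf (f ξ) k ∈ L.Div
      · exact hτ (.track ξ k j p, g) ((tracked_trans_none hA).2 (Or.inl ⟨.loop hd, rfl⟩))
      · obtain ⟨s, hs⟩ := hrun ξ k
        exact hτ (.base s, g) ((tracked_trans_none hA).2 (Or.inl
          ⟨.exit (fun h => hd (hp (Or.inl h))) (fun h => hd (hp (Or.inr h))) hs, rfl⟩))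
  · rintro ⟨s, hs, hτ, hB⟩
    refine ⟨(.base s, G.init), run_tracked_base hA ha hs, ?_, ?_⟩
    · rintro ⟨y, g⟩ htr
      rcases (tracked_trans_none hA).1 htr with ⟨h', -⟩ | ⟨h', -⟩ | ⟨h', -⟩
      · cases h' with
        | base h => exact hτ _ h
      · exact hG.init_not_tau _ h'
      · cases h' with
        | base h => exact hne h rfl
    · rintro b hb ⟨y, g⟩ htr
      obtain ⟨-, h', -⟩ := (tracked_trans_some hA).1 htr
      cases h' with
      | base h => exact hB b hb _ h

end Tracked

/-! ### Infinite traces of the tracked system -/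

/-- `L.OnPath ξ n s`: the state `s` is reached by the prefix of length `n` of `ξ`, and the rest of
`ξ` can be executed from `s`. -/
def OnPath (L : LTS.{u}) (ξ : ℕ → Label.{u}) (n : ℕ) (s : L.State) : Prop :=
  L.Run (prefixOf ξ n) s ∧ L.InfPath (fun i => ξ (i + n)) s

theorem OnPath.exists_step {L : LTS.{u}} {ξ : ℕ → Label.{u}} {n : ℕ} {s : L.State}
    (h : L.OnPath ξ n s) : ∃ s' t, L.TauStar s s' ∧ L.OnPath ξ n s' ∧
      L.trans s' (some (ξ n)) t ∧ L.OnPath ξ (n + 1) t := by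
  obtain ⟨s', t, h₁, h₂, h₃⟩ := h.2.exists_step_shift
  have hr := h.1.tauStar h₁
  exact ⟨s', t, h₁, ⟨hr, InfPath.of_step_shift h₂ h₃⟩, h₂, prefixOf_succ ξ n ▸ hr.vis h₂, h₃⟩

section Tracked

variable {L : LTS.{u}} {Ξ : Type u} {f : Ξ → ℕ → Label.{u}} {hf : ∀ ξ k, f ξ k ∈ L.alphabet}
  {a : Label.{u}} {D : Set ℕ} {G : LTS.{u}} {ζ : ℕ → Label.{u}}

theorem tauStar_tracked_counter (hG : G.alphabet = {a}) {x : TrackState L.State Ξ}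
    {g g' : G.State} (h : G.TauStar g g') :
    (L.tracked f hf a D G).TauStar (x, g) (x, g') :=
  h.lift (fun v => ((x, v) : (L.tracked f hf a D G).State))
    (fun _ _ h => (tracked_trans_none hG).2 (Or.inr (Or.inl ⟨h, rfl⟩)))

theorem Inf_subset_Inf_tracked (hG : G.alphabet = {a}) (ha : a ∉ L.alphabet) :
    L.Inf ⊆ (L.tracked f hf a D G).Inf := by
  intro ξ hξ
  refine Run.mem_Inf (n := 0) (run_tracked_base hG ha Run.init) ?_
  refine InfPath.of_progress (L := L.tracked f hf a D G)
    (X := fun n x => ∃ s, x = (.base s, G.init) ∧ L.InfPath (fun i => ξ (i + n)) s) ?_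
    ⟨L.init, rfl, hξ⟩
  rintro n _ ⟨s, rfl, hs⟩
  obtain ⟨s', t, h₁, h₂, h₃⟩ := hs.exists_step_shift
  refine ⟨(.base s', G.init), (.base t, G.init), ?_, (tracked_trans_some hG).2
    ⟨fun e => ha (e ▸ L.mem_alphabet h₂), .base h₂, rfl⟩, t, rfl, h₃⟩
  exact h₁.lift (fun v => ((.base v, G.init) : (L.tracked f hf a D G).State))
    (fun _ _ h => (tracked_trans_none hG).2 (Or.inl ⟨.base h, rfl⟩))

/-- At most `d` ticks bring the count out of `D`; the first of them also clears `p`, so `p` matters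
only for `d = 0`. -/
theorem exists_tauStar_tracked_ready (hG : G.alphabet = {a}) {ξ : Ξ} {k : ℕ} (d : ℕ) {j : ℕ}
    {p : Prop} {g : G.State} (hj : j + d ∉ D) (hp : d = 0 → ¬ p)
    (hg : G.InfPath (fun _ => a) g) : ∃ j' p' g', ¬ p' ∧ j' ∉ D ∧ G.InfPath (fun _ => a) g' ∧
      (L.tracked f hf a D G).TauStar (.track ξ k j p, g) (.track ξ k j' p', g') := by
  induction d generalizing j p g with
  | zero => exact ⟨j, p, g, hp rfl, hj, hg, Relation.ReflTransGen.refl⟩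
  | succ d ih =>
    by_cases h : p ∨ j ∈ D
    · obtain ⟨g₁, g₂, h₁, h₂, h₃⟩ := hg.exists_step
      obtain ⟨j', p', g', hp', hj', hg', hτ⟩ := ih (j := j + 1) (p := False) (g := g₂)
        (by rwa [show j + 1 + d = j + (d + 1) by omega]) (fun _ => not_false) h₃
      refine ⟨j', p', g', hp', hj', hg', ?_⟩
      exact ((tauStar_tracked_counter hG h₁).tail
        ((tracked_trans_none hG).2 (Or.inr (Or.inr ⟨.tick h, h₂⟩)))).trans hτ
    · rw [not_or] at h
      exact ⟨j, p, g, h.1, h.2, hg, Relation.ReflTransGen.refl⟩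

theorem mem_Inf_tracked (hG : G.alphabet = {a}) (ha : a ∉ L.alphabet)
    (hD : ∀ n, ∃ j, n ≤ j ∧ j ∉ D) (hGa : (fun _ => a) ∈ G.Inf) (ξ : Ξ) :
    f ξ ∈ (L.tracked f hf a D G).Inf := by
  refine Run.mem_Inf (n := 0)
    (Run.init.tau ((tracked_trans_none hG).2 (Or.inl ⟨.enterTrack ξ, rfl⟩))) ?_
  refine InfPath.of_progress (L := L.tracked f hf a D G)
    (X := fun n x => ∃ j p g, x = (.track ξ n j p, g) ∧ G.InfPath (fun _ => a) g) ?_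
    ⟨_, _, _, rfl, hGa⟩
  rintro n _ ⟨j, p, g, rfl, hg⟩
  -- Asking for `m > j` makes `m - j` positive, so the condition on `p` is vacuous.
  obtain ⟨m, hm, hmD⟩ := hD (j + 1)
  obtain ⟨j', p', g', hp', hj', hg', hτ⟩ := exists_tauStar_tracked_ready (hf := hf) hG
    (ξ := ξ) (k := n) (m - j) (j := j) (p := p) (by rwa [show j + (m - j) = m by omega])
    (by omega) hg
  exact ⟨_, (.track ξ (n + 1) j' _, g'), hτ, (tracked_trans_some hG).2
    ⟨fun e => ha (e ▸ hf _ _), .step hp' hj', rfl⟩, j', _, g', rfl, hg'⟩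

theorem tauStar_of_tauStar_tracked_base (hG : G.alphabet = {a}) (ha : a ∉ L.alphabet)
    {s : L.State} {g : G.State} {x : (L.tracked f hf a D G).State}
    (h : (L.tracked f hf a D G).TauStar (.base s, g) x) :
    ∃ t g', x = (.base t, g') ∧ L.TauStar s t := by
  induction h with
  | refl => exact ⟨s, g, rfl, Relation.ReflTransGen.refl⟩
  | @tail x y _ htr ih =>
    obtain ⟨t, g', rfl, ht⟩ := ih
    obtain ⟨y, g''⟩ := y
    rcases (tracked_trans_none hG).1 htr with ⟨h', -⟩ | ⟨-, rfl⟩ | ⟨h', -⟩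
    · cases h' with
      | base h => exact ⟨_, _, rfl, ht.tail h⟩
    · exact ⟨_, _, rfl, ht⟩
    · cases h' with
      | base h => exact (ha (L.mem_alphabet h)).elim

theorem OnPath.mem_Inf_of_base (hG : G.alphabet = {a}) (ha : a ∉ L.alphabet) (h0 : 0 ∉ D)
    {n : ℕ} {s : L.State} {g : G.State}
    (h : (L.tracked f hf a D G).OnPath ζ n (.base s, g)) : ζ ∈ L.Inf := by
  refine Run.mem_Inf (trackInv_of_run hG ha h0 h.1).1 ?_
  refine InfPath.of_progress (X := fun m t => ∃ g',
    (L.tracked f hf a D G).OnPath ζ (m + n) (.base t, g')) ?_ ⟨g, by simpa using h⟩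
  rintro m t ⟨g', hx⟩
  obtain ⟨x, ⟨y, g₂⟩, h₁, -, h₂, h₃⟩ := hx.exists_step
  obtain ⟨s', g₁, rfl, h₄⟩ := tauStar_of_tauStar_tracked_base hG ha h₁
  obtain ⟨-, h', -⟩ := (tracked_trans_some hG).1 h₂
  cases h' with
  | base h => exact ⟨s', _, h₄, h, g₂, by rwa [show m + 1 + n = m + n + 1 by omega]⟩

theorem tauStar_of_tauStar_tracked_track (hG : G.alphabet = {a}) (ha : a ∉ L.alphabet)
    {ξ : Ξ} {k j : ℕ} {p : Prop} {g : G.State} {x : (L.tracked f hf a D G).State}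
    (h : (L.tracked f hf a D G).TauStar (.track ξ k j p, g) x) :
    (∃ t g', x = (.base t, g')) ∨ ∃ j' p' g', x = (.track ξ k j' p', g') := by
  induction h with
  | refl => exact Or.inr ⟨j, p, g, rfl⟩
  | @tail x y _ htr ih =>
    obtain ⟨y, g''⟩ := y
    rcases ih with ⟨t, g', rfl⟩ | ⟨j', p', g', rfl⟩
    · obtain ⟨t, g', e, -⟩ :=
        tauStar_of_tauStar_tracked_base hG ha (Relation.ReflTransGen.single htr)
      exact Or.inl ⟨t, g', e⟩
    · rcases (tracked_trans_none hG).1 htr with ⟨h', -⟩ | ⟨-, rfl⟩ | ⟨h', -⟩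
      · cases h' with
        | loop => exact Or.inr ⟨_, _, _, rfl⟩
        | exit => exact Or.inl ⟨_, _, rfl⟩
      · exact Or.inr ⟨_, _, _, rfl⟩
      · generalize hz : (some a : Act.{u}) = z at h'
        cases h' with
        | tick => exact Or.inr ⟨_, _, _, rfl⟩
        | step => exact (ha (Option.some.inj hz ▸ hf _ _)).elim
        | _ => cases hz

theorem tracked_trans_track_some (hG : G.alphabet = {a}) {ξ : Ξ} {k j : ℕ} {p : Prop}
    {g : G.State} {b : Label.{u}} {x : (L.tracked f hf a D G).State}
    (h : (L.tracked f hf a D G).trans (.track ξ k j p, g) (some b) x) :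
    ¬ p ∧ x = (.track ξ (k + 1) j (prefixOf (f ξ) (k + 1) ∈ L.Div), g) := by
  obtain ⟨y, g'⟩ := x
  obtain ⟨hb, h', rfl⟩ := (tracked_trans_some hG).1 h
  generalize hz : (some b : Act.{u}) = z at h'
  cases h' with
  | tick => exact (hb (Option.some.inj hz)).elim
  | step hp => exact ⟨hp, rfl⟩
  | _ => cases hz

/-- An infinite trace that is not inherited from `L` is executed along some `f ξ`. -/
theorem exists_track_of_mem_Inf (hG : G.alphabet = {a}) (ha : a ∉ L.alphabet) (h0 : 0 ∉ D)
    (hζ : ζ ∈ (L.tracked f hf a D G).Inf) (hL : ζ ∉ L.Inf) : ∃ ξ, ζ = f ξ ∧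
      ∃ j p g, (L.tracked f hf a D G).OnPath ζ 0 (.track ξ 0 j p, g) := by
  have hinit : (L.tracked f hf a D G).OnPath ζ 0 (L.tracked f hf a D G).init := ⟨Run.init, hζ⟩
  have hbase : ∀ {n s g}, ¬ (L.tracked f hf a D G).OnPath ζ n (.base s, g) :=
    fun h => hL (h.mem_Inf_of_base hG ha h0)
  obtain ⟨⟨x, g⟩, ⟨y, g'⟩, -, hx, h₂, -⟩ := hinit.exists_step
  obtain ⟨ξ, j, p, rfl⟩ : ∃ ξ j p, x = .track ξ 0 j p := by
    cases x with
    | start =>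
      obtain ⟨-, h', -⟩ := (tracked_trans_some hG).1 h₂
      cases h'
    | base s => exact (hbase hx).elim
    | track ξ k j p =>
      have e := (trackInv_of_run hG ha h0 hx.1).1
      obtain rfl : 0 = k := by simpa using congrArg List.length e
      exact ⟨ξ, j, p, rfl⟩
  refine ⟨ξ, ?_, j, p, g, hx⟩
  have hall : ∀ n, ∃ j p g, (L.tracked f hf a D G).OnPath ζ n (.track ξ n j p, g) := by
    intro n
    induction n with
    | zero => exact ⟨j, p, g, hx⟩
    | succ n ih =>
      obtain ⟨j, p, g, hn⟩ := ih
      obtain ⟨x, y, h₁, hx, h₂, h₃⟩ := hn.exists_step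
      rcases tauStar_of_tauStar_tracked_track hG ha h₁ with ⟨t, g', rfl⟩ | ⟨j', p', g', rfl⟩
      · exact (hbase hx).elim
      · obtain ⟨-, rfl⟩ := tracked_trans_track_some hG h₂
        exact ⟨_, _, _, h₃⟩
  funext n
  obtain ⟨j, p, g, h⟩ := hall (n + 1)
  have e := (trackInv_of_run hG ha h0 h.1).1
  rw [prefixOf_succ, prefixOf_succ] at e
  exact List.singleton_injective (List.append_inj' e rfl).2

/-- Exiting to a base state would put `ζ` into `L.Inf`, so only loops and invisible steps of the
counter can come before the next tick or label. -/
theorem OnPath.tick_or_step (hG : G.alphabet = {a}) (ha : a ∉ L.alphabet) (h0 : 0 ∉ D)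
    (hL : ζ ∉ L.Inf) {ξ : Ξ} {n j : ℕ} {p : Prop} {g : G.State}
    (h : (L.tracked f hf a D G).OnPath ζ n (.track ξ n j p, g)) :
    (∃ p' g₁ g₂, G.TauStar g g₁ ∧ G.trans g₁ (some a) g₂ ∧
      (L.tracked f hf a D G).OnPath ζ n (.track ξ n (j + 1) p', g₂)) ∨
    (¬ p ∧ ∃ g', G.TauStar g g' ∧ (L.tracked f hf a D G).OnPath ζ (n + 1)
      (.track ξ (n + 1) j (prefixOf (f ξ) (n + 1) ∈ L.Div), g')) := by
  obtain ⟨x, y, h₁, hx, h₂, h₃⟩ := h.exists_step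
  generalize hz : ((.track ξ n j p, g) : (L.tracked f hf a D G).State) = z at h₁ h
  induction h₁ using Relation.ReflTransGen.head_induction_on generalizing g with
  | refl =>
    subst hz
    obtain ⟨hp, rfl⟩ := tracked_trans_track_some hG h₂
    exact Or.inr ⟨hp, g, Relation.ReflTransGen.refl, h₃⟩
  | @head z w htr hτ ih =>
    subst hz
    have hw : (L.tracked f hf a D G).OnPath ζ n w := ⟨h.1.tau htr, hx.2.tauStar hτ⟩
    obtain ⟨w, g'⟩ := w
    rcases (tracked_trans_none hG).1 htr with ⟨h', rfl⟩ | ⟨h', rfl⟩ | ⟨h', hg⟩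
    · cases h' with
      | loop => exact ih rfl hw
      | exit => exact (hL (hw.mem_Inf_of_base hG ha h0)).elim
    · rcases ih rfl hw with ⟨p', g₁, g₂, h₁, h⟩ | ⟨hp, g₁, h₁, h⟩
      · exact Or.inl ⟨p', g₁, g₂, h₁.head h', h⟩
      · exact Or.inr ⟨hp, g₁, h₁.head h', h⟩
    · generalize hz : (some a : Act.{u}) = z at h'
      cases h' with
      | tick => exact Or.inl ⟨_, g, g', Relation.ReflTransGen.refl, hg, hw⟩
      | step => exact (ha (Option.some.inj hz ▸ hf _ _)).elim
      | _ => cases hz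

/-- Here `d` is the distance to a divergent prefix. Arriving there sets `p`, which blocks the next
label until a tick has occurred. -/
theorem OnPath.exists_tick (hG : G.alphabet = {a}) (ha : a ∉ L.alphabet) (h0 : 0 ∉ D)
    (hL : ζ ∉ L.Inf) {ξ : Ξ} (d : ℕ) {n j : ℕ} {p : Prop} {g : G.State}
    (hd : prefixOf (f ξ) (n + d) ∈ L.Div) (hp : d = 0 → p)
    (h : (L.tracked f hf a D G).OnPath ζ n (.track ξ n j p, g)) :
    ∃ n' p' g₁ g₂, G.TauStar g g₁ ∧ G.trans g₁ (some a) g₂ ∧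
      (L.tracked f hf a D G).OnPath ζ n' (.track ξ n' (j + 1) p', g₂) := by
  induction d generalizing n p g with
  | zero =>
    rcases h.tick_or_step hG ha h0 hL with ⟨p', g₁, g₂, h⟩ | ⟨hp', -⟩
    · exact ⟨n, p', g₁, g₂, h⟩
    · exact (hp' (hp rfl)).elim
  | succ d ih =>
    rcases h.tick_or_step hG ha h0 hL with ⟨p', g₁, g₂, h⟩ | ⟨-, g', hg, h⟩
    · exact ⟨n, p', g₁, g₂, h⟩
    · have hd' : prefixOf (f ξ) (n + 1 + d) ∈ L.Div := by
        rwa [show n + 1 + d = n + (d + 1) by omega]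
      obtain ⟨n', p', g₁, g₂, h₁, h₂⟩ := ih hd' (fun e => by simpa [e] using hd') h
      exact ⟨n', p', g₁, g₂, hg.trans h₁, h₂⟩

theorem Inf_tracked_of_mem (hG : G.alphabet = {a}) (ha : a ∉ L.alphabet) (h0 : 0 ∉ D)
    (hD : ∀ n, ∃ j, n ≤ j ∧ j ∉ D) (hGa : (fun _ => a) ∈ G.Inf) :
    (L.tracked f hf a D G).Inf = L.Inf ∪ Set.range f := by
  refine Set.Subset.antisymm (fun ζ hζ => ?_) (Set.union_subset (Inf_subset_Inf_tracked hG ha) ?_)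
  · by_cases hL : ζ ∈ L.Inf
    · exact Or.inl hL
    · obtain ⟨ξ, rfl, -⟩ := exists_track_of_mem_Inf hG ha h0 hζ hL
      exact Or.inr ⟨ξ, rfl⟩
  · rintro _ ⟨ξ, rfl⟩
    exact mem_Inf_tracked hG ha hD hGa ξ

theorem prefixOf_const (a : Label.{u}) (n : ℕ) :
    prefixOf (fun _ => a) n = List.replicate n a := by
  simp [prefixOf]

/-- A new infinite trace would meet infinitely many divergent prefixes and so make the counter tick
for ever. -/
theorem Inf_tracked_of_notMem (hG : G.alphabet = {a}) (ha : a ∉ L.alphabet) (h0 : 0 ∉ D)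
    (hGa : (fun _ => a) ∉ G.Inf)
    (hf' : ∀ ξ, f ξ ∉ L.Inf → ∀ n, ∃ i, n ≤ i ∧ prefixOf (f ξ) i ∈ L.Div) :
    (L.tracked f hf a D G).Inf = L.Inf := by
  refine Set.Subset.antisymm (fun ζ hζ => ?_) (Inf_subset_Inf_tracked hG ha)
  by_contra hL
  obtain ⟨ξ, rfl, j, p, g, h⟩ := exists_track_of_mem_Inf hG ha h0 hζ hL
  refine hGa (Run.mem_Inf (n := j) ?_ (InfPath.of_progress (X := fun m g => ∃ n p,
    (L.tracked f hf a D G).OnPath (f ξ) n (.track ξ n (m + j) p, g)) ?_ ⟨0, p, by simpa using h⟩))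
  · exact prefixOf_const a j ▸ (trackInv_of_run hG ha h0 h.1).2.1
  · rintro m g ⟨n, p, hn⟩
    obtain ⟨i, hi, hd⟩ := hf' ξ hL (n + 1)
    obtain ⟨n', p', g₁, g₂, h₁, h₂, h₃⟩ := hn.exists_tick hG ha h0 hL (i - n)
      (by rwa [show n + (i - n) = i by omega]) (by omega)
    exact ⟨g₁, g₂, h₁, h₂, n', p', by rwa [show m + 1 + j = m + j + 1 by omega]⟩

end Tracked

/-! ### The main theorem -/

/-- `L` is CFFD-equivalent to its version tracked with `G₂`, and replacing `G₂` by `G₁` respects the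
congruence. -/
theorem exists_rel_Inf_union {R : LTS.{u} → LTS.{u} → Prop} (hR : IsCongruence R)
    (hCFFD : ∀ L L' : LTS.{u}, CFFD L L' → R L L') (hSf : Preserves R Sf)
    (hDiv : Preserves R Div) (haenI : ¬ Preserves R aenI) {L L' : LTS.{u}}
    (hA : L.alphabet = L'.alphabet) (hS : L.Sf = L'.Sf) (hD : L.Div = L'.Div)
    (hE : L.eanI = L'.eanI) : ∃ C : LTS.{u}, R L C ∧ C.alphabet = L.alphabet ∧ C.Sf = L.Sf ∧
      C.Div = L.Div ∧ C.Inf = L.Inf ∪ L'.Inf := by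
  obtain ⟨a, ha⟩ := exists_label_notMem L.alphabet L.small_alphabet
  obtain ⟨G₁, G₂, D, hG, hG₁, hG₂, h0, hfreq, hInf₁, hInf₂⟩ := exists_counters hR hSf hDiv haenI a
  have := small_Inf L'
  let f : Shrink.{u} L'.Inf → ℕ → Label.{u} := fun i => ((equivShrink L'.Inf).symm i).1
  have hmem : ∀ i, f i ∈ L'.Inf := fun i => ((equivShrink L'.Inf).symm i).2
  have hrange : Set.range f = L'.Inf := by
    refine Set.Subset.antisymm (Set.range_subset_iff.2 hmem) fun ξ hξ => ?_
    exact ⟨equivShrink L'.Inf ⟨ξ, hξ⟩, by simp [f]⟩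
  have hf : ∀ ξ k, f ξ k ∈ L.alphabet := fun ξ k => hA ▸ mem_alphabet_of_mem_Inf (hmem ξ) k
  have hrun : ∀ ξ k, ∃ s, L.Run (prefixOf (f ξ) k) s := fun ξ k => by
    obtain ⟨s, hs, -⟩ := exists_run_of_mem_Inf (hmem ξ) k
    exact hs.transfer hS.symm hD.symm
  -- The only use of the equality of `eanI`: a trace with finitely many divergent prefixes is
  -- already shared.
  have hdiv : ∀ ξ, f ξ ∉ L.Inf → ∀ n, ∃ i, n ≤ i ∧ prefixOf (f ξ) i ∈ L.Div := by
    intro ξ hξ n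
    by_contra! h
    have hmemE : f ξ ∈ L'.eanI := ⟨hmem ξ, n, fun i hi => hD ▸ h i hi⟩
    exact hξ (hE ▸ hmemE : f ξ ∈ L.eanI).1
  have hCFFD₂ : CFFD L (L.tracked f hf a D G₂) :=
    ⟨(tracked_alphabet hG₂.alphabet ha).symm, (Sf_tracked hG₂ ha h0 hrun).symm,
      (Div_tracked hG₂ ha h0).symm, (Inf_tracked_of_notMem hG₂.alphabet ha h0 hInf₂ hdiv).symm⟩
  refine ⟨L.tracked f hf a D G₁, ?_, tracked_alphabet hG₁.alphabet ha, Sf_tracked hG₁ ha h0 hrun,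
    Div_tracked hG₁ ha h0, ?_⟩
  · exact hR.equivalence.trans (hCFFD _ _ hCFFD₂)
      (hR.hide (hR.par_left (hR.equivalence.symm hG) _) _)
  · rw [Inf_tracked_of_mem hG₁.alphabet ha h0 hfreq hInf₁, hrange]

end LTS

theorem mainTheorem8 (R : LTS.{u} → LTS.{u} → Prop)
    (hcongr : LTS.IsCongruence R)
    (hCFFD : ∀ L L' : LTS.{u}, LTS.CFFD L L' → R L L')
    (hSf : LTS.Preserves R LTS.Sf)
    (hDiv : LTS.Preserves R LTS.Div)
    (haenI : ¬ LTS.Preserves R LTS.aenI) :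
    ∀ L L' : LTS.{u}, R L L' ↔
      (L.alphabet = L'.alphabet ∧ L.Sf = L'.Sf ∧ L.Div = L'.Div ∧ L.eanI = L'.eanI) := by
  intro L L'
  constructor
  · intro h
    exact ⟨LTS.Preserves.alphabet hcongr hSf hDiv _ _ h, hSf _ _ h, hDiv _ _ h,
      LTS.Preserves.eanI hcongr hSf hDiv _ _ h⟩
  · rintro ⟨hA, hS, hD, hE⟩
    obtain ⟨C, hC, hCA, hCS, hCD, hCI⟩ :=
      LTS.exists_rel_Inf_union hcongr hCFFD hSf hDiv haenI hA hS hD hE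
    obtain ⟨C', hC', hCA', hCS', hCD', hCI'⟩ :=
      LTS.exists_rel_Inf_union hcongr hCFFD hSf hDiv haenI hA.symm hS.symm hD.symm hE.symm
    have hCC' : R C C' := hCFFD _ _ ⟨hCA.trans (hA.trans hCA'.symm), hCS.trans (hS.trans hCS'.symm),
      hCD.trans (hD.trans hCD'.symm), by rw [hCI, hCI', Set.union_comm]⟩
    exact hcongr.equivalence.trans hC
      (hcongr.equivalence.trans hCC' (hcongr.equivalence.symm hC'))
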